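/- Write $\mathcal P[0,1]$ for the space of Borel probability measures on $[0,1]$. A *qmm-space* $(X,\mu,d^*)$ is a standard Borel space $X$ with a Borel probability measure $\mu$ and a Borel map $d^*:X\times X\to\mathcal P[0,1]$ such that $d^*(x,x)=\delta_0$, $d^*(x,y)=d^*(y,x)$ and, for $\mu^3$-almost every triple $(a,b,c)$ of pairwise different points, independent random lengths with laws $d^*(a,b),d^*(b,c),d^*(a,c)$ satisfy the triangle inequalities almost surely. *Ultralimits.* Let $\omega$ be a nonprincipal ultrafilter on the index set $\{1,2,\dots\}$ and let $(X_n,\mu_n)$ be probability spaces. The ultralimit $\mathbf X$ is the set of classes $[(x_n)]$ of sequences $x_n\in X_n$, two sequences being identified if they agree on a set of indices in $\omega$. The ultralimit $\mathbf A\subseteq\mathbf X$ of measurable sets $A_n\subseteq X_n$ is the set of all $[(x_n)]$ with $\{n: x_n\in A_n\}\in\omega$; put $\mu_{\mathbf X}(\mathbf A)=\lim_\omega\mu_n(A_n)$. A set is null if for every $\varepsilon>0$ it is contained in such an $\mathbf A$ with $\mu_{\mathbf X}(\mathbf A)<\varepsilon$. The $\sigma$-algebra $\mathcal M$ consists of the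 sets $M$ for which $M\triangle\mathbf A$ is null for some such $\mathbf A$, and $\mu_{\mathbf X}(M)=\mu_{\mathbf X}(\mathbf A)$. The same construction for the spaces $(X_n\times X_n,\mu_n\times\mu_n)$ gives a $\sigma$-algebra $\mathcal M_2\supseteq\mathcal M\times\mathcal M$ and a probability measure $\mu_{\mathbf X}^2$ on $\mathbf X\times\mathbf X$. Functions $d_n:X_n\times X_n\to[0,1]$ have the ultralimit $\mathbf d([(x_n)],[(y_n)])=\lim_\omega d_n(x_n,y_n)$. A version of $\mathbf d^*_{\mathbf X}=E(\delta_{\mathbf d}\mid\mathcal M\times\mathcal M)$ is a map $D:\mathbf X\times\mathbf X\to\mathcal P[0,1]$ such that for every $g\in C[0,1]$ the function $p\mapsto\int g\,dD(p)$ is $\mathcal M\times\mathcal M$-measurable and $\int_B\int g\,dD(p)\,d\mu_{\mathbf X}^2(p)=\int_B g(\mathbf d(p))\,d\mu^2_{\mathbf X}(p)$ for all $B\in\mathcal M\times\mathcal M$. **Theorem.** Let $(X,\mu,d^*)$ be a qmm-space whose underlying Borel space is that of a compact metric space $X$ (for example $X=[0,1]$; every non-empty standard Borel space is Borel isomorphic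 to a compact metric space), and let $\omega$ be a nonprincipal ultrafilter. Pick independent $\mu$-random points $x_1,x_2,\dots$ and, given these, independent numbers $d(i,j)$, $i<j$, with laws $d^*(x_i,x_j)$; put $d(j,i)=d(i,j)$ and $d(i,i)=0$. Let $X_n=\{1,\dots,n\}$ with the uniform probability measure and the distance function $d$, let $\pi_n:X_n\to X$, $\pi_n(i)=x_i$, let $\mathbf X$ be the ultralimit of the $X_n$, and let $\pi:\mathbf X\to X$, $\pi([(i_n)])=\lim_\omega\pi_n(i_n)$. Then with probability one $\pi$ is a separable realization: $\pi$ is measurable, $\pi_*(\mu_{\mathbf X})=\mu$, versions of $\mathbf d^*_{\mathbf X}$ exist, and for each of them $d^*(\pi(p),\pi(q))=\mathbf d^*_{\mathbf X}(p,q)$ for $\mu_{\mathbf X}^2$-almost every $(p,q)\in\mathbf X\times\mathbf X$. -/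

import Mathlib

open MeasureTheory ProbabilityTheory Filter Topology Set
open scoped unitInterval ENNReal

noncomputable section

namespace QMM

/-! ## Ultralimits of points, sets and functions -/

/-- A nonprincipal ultrafilter on `ℕ`. -/
class Nonprincipal (ω : Ultrafilter ℕ) : Prop where
  ne_pure : ∀ n, ω ≠ pure n

/-- The ultralimit `lim_ω y_n` of a sequence of points (in a compact Hausdorff space). -/
def ulim {Y : Type*} [TopologicalSpace Y] (ω : Ultrafilter ℕ) (y : ℕ → Y) : Y :=
  (ω.map y).lim

theorem tendsto_ulim {Y : Type*} [TopologicalSpace Y] [CompactSpace Y] (ω : Ultrafilter ℕ)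
    (y : ℕ → Y) : Tendsto y ω (𝓝 (ulim ω y)) :=
  (ω.map y).le_nhds_lim

theorem ulim_congr {Y : Type*} [TopologicalSpace Y] (ω : Ultrafilter ℕ) {y z : ℕ → Y}
    (h : ∀ᶠ n in (ω : Filter ℕ), y n = z n) : ulim ω y = ulim ω z := by
  have : ω.map y = ω.map z := by
    apply Ultrafilter.coe_injective
    rw [Ultrafilter.coe_map, Ultrafilter.coe_map]
    exact Filter.map_congr h
  rw [ulim, ulim, this]

theorem Nonprincipal.eventually_ge (ω : Ultrafilter ℕ) [h : Nonprincipal ω] (k : ℕ) :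
    ∀ᶠ n in (ω : Filter ℕ), k ≤ n := by
  have h1 : (ω : Filter ℕ) ≤ cofinite := by
    rcases ω.le_cofinite_or_eq_pure with h' | ⟨a, ha⟩
    · exact h'
    · exact absurd ha (h.ne_pure a)
  rw [Nat.cofinite_eq_atTop] at h1
  exact h1 (eventually_ge_atTop k)

section Loeb

variable {X : ℕ → Type*} [∀ n, MeasurableSpace (X n)]

/-- The set-theoretic ultralimit of the probability spaces `(X n, P n)`: sequences of points, two
sequences being identified when they agree on a set of indices that belongs to `ω`. The measures
are recorded in the type because they determine its σ-algebra. -/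
def UltraProd (ω : Ultrafilter ℕ) (_P : ∀ n, Measure (X n)) : Type _ :=
  (ω : Filter ℕ).Product X

namespace UltraProd

/-- The class `[x]` of a sequence. -/
def mk (ω : Ultrafilter ℕ) (P : ∀ n, Measure (X n)) (x : ∀ n, X n) : UltraProd ω P :=
  Quotient.mk (productSetoid (ω : Filter ℕ) X) x

variable {ω : Ultrafilter ℕ} {P : ∀ n, Measure (X n)}

/-- The ultralimit of maps `f n : X n → Y`, that is `[x] ↦ lim_ω f n (x n)`. -/
def ulimFun {Y : Type*} [TopologicalSpace Y] (f : ∀ n, X n → Y) : UltraProd ω P → Y :=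
  Quotient.lift (fun x : ∀ n, X n => ulim ω fun n => f n (x n)) fun x y h => by
    have h' : ∀ᶠ n in (ω : Filter ℕ), x n = y n := h
    exact ulim_congr ω (h'.mono fun n hn => by rw [hn])

/-- The map `[x] ↦ [f n (x n)]` between ultralimits. -/
def map {Y : ℕ → Type*} [∀ n, MeasurableSpace (Y n)] {R : ∀ n, Measure (Y n)}
    (f : ∀ n, X n → Y n) : UltraProd ω P → UltraProd ω R :=
  Quotient.lift (fun x : ∀ n, X n => mk ω R fun n => f n (x n)) fun x y h => by
    have h' : ∀ᶠ n in (ω : Filter ℕ), x n = y n := h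
    refine Quotient.sound ?_
    change ∀ᶠ n in (ω : Filter ℕ), f n (x n) = f n (y n)
    exact h'.mono fun n hn => by rw [hn]

/-- The ultralimit of the sets `A n`: `[x]` belongs to it iff `{n | x n ∈ A n} ∈ ω`. -/
def internal (ω : Ultrafilter ℕ) (P : ∀ n, Measure (X n)) (A : ∀ n, Set (X n)) :
    Set (UltraProd ω P) :=
  {q | ∃ x, mk ω P x = q ∧ ∀ᶠ n in (ω : Filter ℕ), x n ∈ A n}

/-- The finitely additive measure `lim_ω P n (A n)` of the ultralimit of the sets `A n`. -/
def content (ω : Ultrafilter ℕ) (P : ∀ n, Measure (X n)) (A : ∀ n, Set (X n)) : ℝ≥0∞ :=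
  ulim ω fun n => P n (A n)

/-- Null sets: sets covered by ultralimit sets of arbitrarily small measure. -/
def IsNull (N : Set (UltraProd ω P)) : Prop :=
  ∀ ε : ℝ≥0∞, 0 < ε → ∃ A : ∀ n, Set (X n), (∀ n, MeasurableSet (A n)) ∧
    N ⊆ internal ω P A ∧ content ω P A < ε

/-- `M` agrees with the ultralimit of the measurable sets `A n` up to a null set. -/
def Approx (A : ∀ n, Set (X n)) (M : Set (UltraProd ω P)) : Prop :=
  (∀ n, MeasurableSet (A n)) ∧ IsNull (symmDiff (internal ω P A) M)

theorem mk_surj (q : UltraProd ω P) : ∃ x, mk ω P x = q := Quotient.exists_rep q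

theorem mk_mem_internal {A : ∀ n, Set (X n)} {x : ∀ n, X n} :
    mk ω P x ∈ internal ω P A ↔ ∀ᶠ n in (ω : Filter ℕ), x n ∈ A n := by
  constructor
  · rintro ⟨y, hy, h⟩
    have : ∀ᶠ n in (ω : Filter ℕ), y n = x n := Quotient.exact hy
    filter_upwards [h, this] with n h1 h2
    rwa [← h2]
  · exact fun h => ⟨x, rfl, h⟩

theorem internal_mono {A B : ∀ n, Set (X n)} (h : ∀ᶠ n in (ω : Filter ℕ), A n ⊆ B n) :
    internal ω P A ⊆ internal ω P B := by
  rintro _ ⟨x, rfl, hx⟩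
  rw [mk_mem_internal]
  filter_upwards [h, hx] with n h1 h2 using h1 h2

theorem compl_internal (A : ∀ n, Set (X n)) :
    (internal ω P A)ᶜ = internal ω P fun n => (A n)ᶜ := by
  ext q
  obtain ⟨x, rfl⟩ := mk_surj q
  rw [mem_compl_iff, mk_mem_internal, mk_mem_internal, ← Ultrafilter.eventually_not]
  rfl

theorem internal_union (A B : ∀ n, Set (X n)) :
    (internal ω P fun n => A n ∪ B n) = internal ω P A ∪ internal ω P B := by
  ext q
  obtain ⟨x, rfl⟩ := mk_surj q
  rw [mem_union, mk_mem_internal, mk_mem_internal, mk_mem_internal, ← Ultrafilter.eventually_or]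
  rfl

theorem internal_inter (A B : ∀ n, Set (X n)) :
    (internal ω P fun n => A n ∩ B n) = internal ω P A ∩ internal ω P B := by
  ext q
  obtain ⟨x, rfl⟩ := mk_surj q
  rw [mem_inter_iff, mk_mem_internal, mk_mem_internal, mk_mem_internal, ← eventually_and]
  rfl

theorem internal_diff (A B : ∀ n, Set (X n)) :
    (internal ω P fun n => A n \ B n) = internal ω P A \ internal ω P B := by
  simp only [sdiff_eq, compl_internal]
  exact internal_inter A fun n => (B n)ᶜ

theorem internal_empty : (internal ω P fun _ => ∅) = ∅ := by
  ext q
  obtain ⟨x, rfl⟩ := mk_surj q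
  rw [mk_mem_internal]
  simp [ω.neBot.ne]

theorem eventually_subset [∀ n, Nonempty (X n)] {A B : ∀ n, Set (X n)}
    (h : internal ω P A ⊆ internal ω P B) : ∀ᶠ n in (ω : Filter ℕ), A n ⊆ B n := by
  by_contra hc
  rw [← Ultrafilter.eventually_not] at hc
  have : ∀ n, ∃ x : X n, ¬ A n ⊆ B n → x ∈ A n ∧ x ∉ B n := by
    intro n
    by_cases hn : A n ⊆ B n
    · exact ⟨Classical.arbitrary _, fun h' => absurd hn h'⟩
    · obtain ⟨x, hx⟩ := Set.not_subset.1 hn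
      exact ⟨x, fun _ => hx⟩
  choose x hx using this
  have h1 : mk ω P x ∈ internal ω P A :=
    mk_mem_internal.2 (hc.mono fun n hn => (hx n hn).1)
  have h2 := mk_mem_internal.1 (h h1)
  obtain ⟨n, hn1, hn2⟩ := (hc.and h2).exists
  exact (hx n hn1).2 hn2

theorem tendsto_content (A : ∀ n, Set (X n)) :
    Tendsto (fun n => P n (A n)) ω (𝓝 (content ω P A)) := tendsto_ulim ω _

theorem content_mono {A B : ∀ n, Set (X n)} (h : ∀ᶠ n in (ω : Filter ℕ), A n ⊆ B n) :
    content ω P A ≤ content ω P B :=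
  le_of_tendsto_of_tendsto (tendsto_content A) (tendsto_content B)
    (h.mono fun _ hn => measure_mono hn)

theorem content_empty : content ω P (fun _ => ∅) = 0 := by
  refine tendsto_nhds_unique (tendsto_content _) ?_
  simp

theorem content_union_add_inter (A : ∀ n, Set (X n)) {B : ∀ n, Set (X n)}
    (hB : ∀ n, MeasurableSet (B n)) :
    (content ω P fun n => A n ∪ B n) + (content ω P fun n => A n ∩ B n) =
      content ω P A + content ω P B := by
  refine tendsto_nhds_unique ((tendsto_content _).add (tendsto_content _)) ?_
  simp only [fun n => measure_union_add_inter (μ := P n) (A n) (hB n)]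
  exact (tendsto_content A).add (tendsto_content B)

theorem content_union_le (A B : ∀ n, Set (X n)) :
    (content ω P fun n => A n ∪ B n) ≤ content ω P A + content ω P B :=
  le_of_tendsto_of_tendsto' (tendsto_content _) ((tendsto_content A).add (tendsto_content B))
    fun _ => measure_union_le _ _

theorem content_diff_add {A B : ∀ n, Set (X n)} (hB : ∀ n, MeasurableSet (B n))
    (h : ∀ᶠ n in (ω : Filter ℕ), B n ⊆ A n) :
    (content ω P fun n => A n \ B n) + content ω P B = content ω P A := by
  refine tendsto_nhds_unique ((tendsto_content _).add (tendsto_content _)) ?_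
  refine (tendsto_content A).congr' (h.mono fun n hn => ?_)
  rw [← measure_sdiff_add_inter (μ := P n) (A n) (hB n), inter_eq_right.2 hn]

theorem content_le_one [∀ n, IsProbabilityMeasure (P n)] (A : ∀ n, Set (X n)) :
    content ω P A ≤ 1 :=
  le_of_tendsto' (tendsto_content A) fun _ => prob_le_one

theorem measurableSet_accumulate {Y : Type*} [MeasurableSpace Y] {A : ℕ → Set Y}
    (h : ∀ j, MeasurableSet (A j)) (k : ℕ) : MeasurableSet (accumulate A k) := by
  induction k with
  | zero => simpa [accumulate_zero_nat] using h 0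
  | succ k ih => rw [accumulate_succ]; exact ih.union (h _)

/-- Countable saturation with control of the measure. -/
theorem saturation [Nonprincipal ω] {B : ℕ → ∀ n, Set (X n)}
    (hB : ∀ k n, MeasurableSet (B k n)) (hmono : ∀ n, Monotone fun k => B k n)
    {a : ℝ≥0∞} (ha : a ≠ ∞) (hBa : ∀ k, content ω P (B k) ≤ a) :
    ∃ A : ∀ n, Set (X n), (∀ n, MeasurableSet (A n)) ∧
      (∀ k, ∀ᶠ n in (ω : Filter ℕ), B k n ⊆ A n) ∧ content ω P A ≤ a := by
  classical
  let S : ℕ → ℕ → Prop := fun n k => P n (B k n) ≤ a + ((k : ℝ≥0∞) + 1)⁻¹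
  have hS : ∀ k, ∀ᶠ n in (ω : Filter ℕ), S n k := by
    intro k
    have hlt : content ω P (B k) < a + ((k : ℝ≥0∞) + 1)⁻¹ :=
      lt_of_le_of_lt (hBa k) (ENNReal.lt_add_right ha (by simp))
    exact ((tendsto_content (B k)).eventually_lt_const hlt).mono fun n hn => hn.le
  let h : ℕ → ℕ := fun n => Nat.findGreatest (S n) n
  have hh : ∀ k, ∀ᶠ n in (ω : Filter ℕ), k ≤ h n := fun k => by
    filter_upwards [hS k, Nonprincipal.eventually_ge ω k] with n h1 h2
    exact Nat.le_findGreatest h2 h1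
  refine ⟨fun n => B (h n) n, fun n => hB _ n, fun k => ?_, ?_⟩
  · filter_upwards [hh k] with n hn using hmono n hn
  · have key : ∀ k : ℕ, content ω P (fun n => B (h n) n) ≤ a + ((k : ℝ≥0∞) + 1)⁻¹ := by
      intro k
      refine le_of_tendsto (tendsto_content _) ?_
      filter_upwards [hS 0, hh k] with n h0 hk
      have hs : S n (h n) := Nat.findGreatest_spec (Nat.zero_le n) h0
      refine hs.trans ?_
      gcongr
    have hlim : Tendsto (fun k : ℕ => a + ((k : ℝ≥0∞) + 1)⁻¹) atTop (𝓝 (a + 0)) := by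
      refine tendsto_const_nhds.add ?_
      have := (tendsto_add_atTop_iff_nat 1).2 ENNReal.tendsto_inv_nat_nhds_zero
      simpa using this
    rw [add_zero] at hlim
    exact ge_of_tendsto' hlim key

theorem IsNull.mono {N N' : Set (UltraProd ω P)} (h : IsNull N) (hs : N' ⊆ N) : IsNull N' :=
  fun ε hε => let ⟨A, h1, h2, h3⟩ := h ε hε; ⟨A, h1, hs.trans h2, h3⟩

theorem isNull_empty : IsNull (∅ : Set (UltraProd ω P)) :=
  fun _ hε => ⟨fun _ => ∅, fun _ => .empty, empty_subset _, by rwa [content_empty]⟩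

theorem content_accumulate_le (A : ℕ → ∀ n, Set (X n)) (k : ℕ) :
    (content ω P fun n => accumulate (fun j => A j n) k) ≤
      ∑ j ∈ Finset.range (k + 1), content ω P (A j) := by
  induction k with
  | zero => simp [accumulate_zero_nat]
  | succ k ih =>
    simp only [accumulate_succ]
    rw [Finset.sum_range_succ]
    exact (content_union_le _ _).trans (by gcongr)

theorem IsNull.iUnion [Nonprincipal ω] {N : ℕ → Set (UltraProd ω P)} (h : ∀ k, IsNull (N k)) :
    IsNull (⋃ k, N k) := by
  intro ε hε
  obtain ⟨δ, hδ0, hδ⟩ := ENNReal.exists_pos_sum_of_countable' hε.ne' ℕ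
  choose A hA hNA hAδ using fun k => h k (δ k) (hδ0 k)
  obtain ⟨C, hC, hBC, hCa⟩ := saturation (ω := ω) (P := P)
    (B := fun k n => accumulate (fun j => A j n) k)
    (fun k n => measurableSet_accumulate (fun j => hA j n) k)
    (fun n => monotone_accumulate) (a := ∑' k, δ k) (ne_top_of_lt hδ) (fun k =>
      (content_accumulate_le A k).trans
        ((Finset.sum_le_sum fun j _ => (hAδ j).le).trans (ENNReal.sum_le_tsum _)))
  refine ⟨C, hC, iUnion_subset fun k => (hNA k).trans (internal_mono ?_), hCa.trans_lt hδ⟩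
  filter_upwards [hBC k] with n hn
  exact (subset_accumulate (s := fun j => A j n)).trans hn

theorem IsNull.union [Nonprincipal ω] {N N' : Set (UltraProd ω P)} (h : IsNull N)
    (h' : IsNull N') : IsNull (N ∪ N') := by
  rw [union_eq_iUnion]
  have : ⋃ b : Bool, cond b N N' ⊆ ⋃ k : ℕ, (if k = 0 then N else N') := by
    refine iUnion_subset fun b => ?_
    cases b
    · exact subset_iUnion_of_subset 1 (by simp)
    · exact subset_iUnion_of_subset 0 (by simp)
  refine IsNull.mono (IsNull.iUnion fun k => ?_) this
  split_ifs <;> assumption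

theorem IsNull.content_eq_zero [∀ n, Nonempty (X n)] {A : ∀ n, Set (X n)}
    (h : IsNull (internal ω P A)) : content ω P A = 0 := by
  by_contra hc
  obtain ⟨B, -, h2, h3⟩ := h _ (pos_iff_ne_zero.2 hc)
  exact absurd (content_mono (P := P) (eventually_subset h2)) (not_le.2 h3)

theorem Approx.compl {A : ∀ n, Set (X n)} {M : Set (UltraProd ω P)} (h : Approx A M) :
    Approx (fun n => (A n)ᶜ) Mᶜ := by
  refine ⟨fun n => (h.1 n).compl, ?_⟩
  rw [← compl_internal, compl_symmDiff_compl]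
  exact h.2

theorem Approx.content_le [∀ n, Nonempty (X n)] [Nonprincipal ω] {A B : ∀ n, Set (X n)}
    {M : Set (UltraProd ω P)} (hA : Approx A M) (hB : Approx B M) :
    content ω P A ≤ content ω P B := by
  have h0 : IsNull (internal ω P fun n => A n \ B n) := by
    refine (hA.2.union hB.2).mono ?_
    rw [internal_diff]
    intro x hx
    by_cases hM : x ∈ M
    · exact Or.inr (Or.inr ⟨hM, hx.2⟩)
    · exact Or.inl (Or.inl ⟨hx.1, hM⟩)
  calc content ω P A ≤ content ω P fun n => (A n \ B n) ∪ B n :=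
        content_mono (Eventually.of_forall fun n => by
          rw [sdiff_union_self]; exact subset_union_left)
    _ ≤ (content ω P fun n => A n \ B n) + content ω P B := content_union_le _ _
    _ = content ω P B := by rw [h0.content_eq_zero, zero_add]

theorem Approx.content_eq [∀ n, Nonempty (X n)] [Nonprincipal ω] {A B : ∀ n, Set (X n)}
    {M : Set (UltraProd ω P)} (hA : Approx A M) (hB : Approx B M) :
    content ω P A = content ω P B :=
  (hA.content_le hB).antisymm (hB.content_le hA)

theorem Approx.iUnion [∀ n, IsProbabilityMeasure (P n)] [Nonprincipal ω]
    {A : ℕ → ∀ n, Set (X n)} {M : ℕ → Set (UltraProd ω P)} (h : ∀ k, Approx (A k) (M k)) :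
    ∃ C : ∀ n, Set (X n), Approx C (⋃ k, M k) ∧
      content ω P C = ⨆ k, content ω P fun n => accumulate (fun j => A j n) k := by
  set B : ℕ → ∀ n, Set (X n) := fun k n => accumulate (fun j => A j n) k with hBdef
  have hBm : ∀ k n, MeasurableSet (B k n) :=
    fun k n => measurableSet_accumulate (fun j => (h j).1 n) k
  set a : ℝ≥0∞ := ⨆ k, content ω P (B k) with ha
  have ha1 : a ≠ ∞ := ne_top_of_le_ne_top ENNReal.one_ne_top (iSup_le fun k => content_le_one _)
  obtain ⟨C, hC, hBC, hCa⟩ := saturation (ω := ω) (P := P) hBm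
    (fun n => monotone_accumulate) ha1 (fun k => le_iSup (fun k => content ω P (B k)) k)
  have hAC : ∀ k, internal ω P (A k) ⊆ internal ω P C := fun k => internal_mono <| by
    filter_upwards [hBC k] with n hn
    exact (subset_accumulate (s := fun j => A j n)).trans hn
  have hBu : ∀ k, internal ω P (B k) ⊆ ⋃ j, internal ω P (A j) := by
    intro k
    induction k with
    | zero =>
      simp only [hBdef, accumulate_zero_nat]
      exact subset_iUnion (fun j => internal ω P (A j)) 0
    | succ k ih =>
      simp only [hBdef, accumulate_succ]
      rw [internal_union]
      exact union_subset ih (subset_iUnion (fun j => internal ω P (A j)) (k + 1))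
  have hnull : IsNull (internal ω P C \ ⋃ j, internal ω P (A j)) := by
    intro ε hε
    have hex : ∃ k, a < content ω P (B k) + ε := by
      by_contra hc
      push Not at hc
      have h1 : a + ε ≤ a := by
        rw [ha, ENNReal.iSup_add]
        exact iSup_le hc
      exact absurd h1 (not_le.2 (ENNReal.lt_add_right ha1 hε.ne'))
    obtain ⟨k, hk⟩ := hex
    refine ⟨fun n => C n \ B k n, fun n => (hC n).diff (hBm k n), ?_, ?_⟩
    · rw [internal_diff]
      exact sdiff_subset_sdiff_right (hBu k)
    · have h1 := content_diff_add (P := P) (hBm k) (hBC k)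
      have h2 : (content ω P fun n => C n \ B k n) + content ω P (B k) <
          ε + content ω P (B k) := by
        rw [h1, add_comm ε]
        exact hCa.trans_lt hk
      exact lt_of_add_lt_add_right h2
  refine ⟨C, ⟨hC, ?_⟩, le_antisymm hCa (iSup_le fun k => content_mono (hBC k))⟩
  refine ((IsNull.iUnion fun k => (h k).2).union hnull).mono ?_
  rintro x (⟨hx, hM⟩ | ⟨hM, hx⟩)
  · by_cases hj : x ∈ ⋃ j, internal ω P (A j)
    · obtain ⟨j, hj⟩ := mem_iUnion.1 hj
      exact Or.inl (mem_iUnion.2 ⟨j, Or.inl ⟨hj, fun h' => hM (mem_iUnion.2 ⟨j, h'⟩)⟩⟩)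
    · exact Or.inr ⟨hx, hj⟩
  · obtain ⟨j, hj⟩ := mem_iUnion.1 hM
    exact Or.inl (mem_iUnion.2 ⟨j, Or.inr ⟨hj, fun h' => hx (hAC j h')⟩⟩)

theorem content_accumulate [∀ n, Nonempty (X n)] [Nonprincipal ω]
    {A : ℕ → ∀ n, Set (X n)} {M : ℕ → Set (UltraProd ω P)} (h : ∀ k, Approx (A k) (M k))
    (hd : Pairwise fun i j => Disjoint (M i) (M j)) (k : ℕ) :
    (content ω P fun n => accumulate (fun j => A j n) k) =
      ∑ j ∈ Finset.range (k + 1), content ω P (A j) := by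
  have hBu : ∀ k, (internal ω P fun n => accumulate (fun j => A j n) k) ⊆
      ⋃ j ≤ k, internal ω P (A j) := by
    intro k
    induction k with
    | zero =>
      simp only [accumulate_zero_nat]
      exact subset_iUnion₂ (s := fun j (_ : j ≤ 0) => internal ω P (A j)) 0 le_rfl
    | succ k ih =>
      simp only [accumulate_succ]
      rw [internal_union]
      refine union_subset (ih.trans (iUnion₂_subset fun j hj => ?_)) ?_
      · exact subset_iUnion₂ (s := fun j (_ : j ≤ k + 1) => internal ω P (A j)) j (by omega)
      · exact subset_iUnion₂ (s := fun j (_ : j ≤ k + 1) => internal ω P (A j)) (k + 1) le_rfl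
  induction k with
  | zero => simp [accumulate_zero_nat]
  | succ k ih =>
    simp only [accumulate_succ]
    rw [Finset.sum_range_succ, ← ih]
    have h0 : IsNull (internal ω P fun n => accumulate (fun j => A j n) k ∩ A (k + 1) n) := by
      refine (IsNull.iUnion fun k => (h k).2).mono ?_
      rw [internal_inter]
      rintro x ⟨hx1, hx2⟩
      obtain ⟨j, hjk, hj⟩ := mem_iUnion₂.1 (hBu k hx1)
      by_cases hM : x ∈ M (k + 1)
      · refine mem_iUnion.2 ⟨j, Or.inl ⟨hj, fun h' => ?_⟩⟩
        exact disjoint_left.1 (hd (show j ≠ k + 1 by omega)) h' hM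
      · exact mem_iUnion.2 ⟨k + 1, Or.inl ⟨hx2, hM⟩⟩
    have := content_union_add_inter (ω := ω) (P := P)
      (fun n => accumulate (fun j => A j n) k) (h (k + 1)).1
    rwa [h0.content_eq_zero, add_zero] at this

/-- The σ-algebra `𝓜` of the ultralimit: the sets that agree with the ultralimit of a sequence of
measurable sets up to a null set. -/
instance instMeasurableSpace [∀ n, IsProbabilityMeasure (P n)] [Nonprincipal ω] :
    MeasurableSpace (UltraProd ω P) where
  MeasurableSet' M := ∃ A, Approx A M
  measurableSet_empty := ⟨fun _ => ∅, fun _ => .empty, by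
    rw [internal_empty]; simpa using isNull_empty⟩
  measurableSet_compl _ := fun ⟨_, hA⟩ => ⟨_, hA.compl⟩
  measurableSet_iUnion M hM := by
    choose A hA using hM
    obtain ⟨C, hC, -⟩ := Approx.iUnion hA
    exact ⟨C, hC⟩

theorem exists_approx [∀ n, IsProbabilityMeasure (P n)] [Nonprincipal ω]
    {M : Set (UltraProd ω P)} (hM : MeasurableSet M) : ∃ A, Approx A M := hM

/-- The measure of a set `M ∈ 𝓜` is `lim_ω P n (A n)` for any measurable sets `A n` whose
ultralimit agrees with `M` up to a null set. -/
def value [∀ n, IsProbabilityMeasure (P n)] [Nonprincipal ω] (M : Set (UltraProd ω P))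
    (hM : MeasurableSet M) : ℝ≥0∞ :=
  content ω P (exists_approx hM).choose

theorem value_eq [∀ n, IsProbabilityMeasure (P n)] [Nonprincipal ω] {A : ∀ n, Set (X n)}
    {M : Set (UltraProd ω P)} (hM : MeasurableSet M) (h : Approx A M) :
    value M hM = content ω P A :=
  have : ∀ n, Nonempty (X n) := fun n => (P n).nonempty_of_neZero
  Approx.content_eq (exists_approx hM).choose_spec h

/-- The ultralimit measure. -/
instance instMeasureSpace [∀ n, IsProbabilityMeasure (P n)] [Nonprincipal ω] :
    MeasureSpace (UltraProd ω P) where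
  volume := Measure.ofMeasurable
    (fun M hM => value M hM)
    (by
      rw [← content_empty (ω := ω) (P := P)]
      refine value_eq _ ⟨fun _ => .empty, ?_⟩
      rw [internal_empty]
      simpa using isNull_empty)
    (by
      have : ∀ n, Nonempty (X n) := fun n => (P n).nonempty_of_neZero
      intro M hM hd
      choose A hA using fun k => exists_approx (hM k)
      obtain ⟨C, hC, hCc⟩ := Approx.iUnion hA
      rw [value_eq _ hC, hCc, ENNReal.tsum_eq_iSup_nat' (tendsto_add_atTop_nat 1)]
      simp only [fun k => value_eq (hM k) (hA k)]
      exact iSup_congr fun k => content_accumulate hA hd k)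

theorem volume_eq [∀ n, IsProbabilityMeasure (P n)] [Nonprincipal ω] {A : ∀ n, Set (X n)}
    {M : Set (UltraProd ω P)} (h : Approx A M) :
    (volume : Measure (UltraProd ω P)) M = content ω P A := by
  have hM : MeasurableSet M := ⟨A, h⟩
  refine (Measure.ofMeasurable_apply M hM).trans ?_
  exact value_eq _ h

end UltraProd

/-! ## The square of an ultralimit and the conditional distance -/

/-- The ultralimit of the spaces `X n × X n`; as a set it is the square of the ultralimit of the
`X n` through the two projections below, its σ-algebra is `𝓜₂`. -/
abbrev UltraSq (ω : Ultrafilter ℕ) (P : ∀ n, Measure (X n)) : Type _ :=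
  UltraProd ω fun n => (P n).prod (P n)

/-- First coordinate on the square. -/
def UltraSq.fst {ω : Ultrafilter ℕ} {P : ∀ n, Measure (X n)} (p : UltraSq ω P) : UltraProd ω P :=
  UltraProd.map (fun _ => Prod.fst) p

/-- Second coordinate on the square. -/
def UltraSq.snd {ω : Ultrafilter ℕ} {P : ∀ n, Measure (X n)} (p : UltraSq ω P) : UltraProd ω P :=
  UltraProd.map (fun _ => Prod.snd) p

/-- The product σ-algebra `𝓜 × 𝓜` on the square. -/
@[reducible] def UltraSq.prodAlgebra (ω : Ultrafilter ℕ) (P : ∀ n, Measure (X n))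
    [∀ n, IsProbabilityMeasure (P n)] [Nonprincipal ω] : MeasurableSpace (UltraSq ω P) :=
  MeasurableSpace.comap UltraSq.fst inferInstance ⊔ MeasurableSpace.comap UltraSq.snd inferInstance

end Loeb

/-- `E` is a version of the conditional expectation of `s ↦ δ_{f s}` with respect to the
sub-σ-algebra `𝓑` (Radon–Nikodym–Dunford–Pettis derivative): it is weak-* measurable with respect
to `𝓑`, and `∫_B ⟨E, g⟩ dν = ∫_B g ∘ f dν` for all `g ∈ C[0,1]` and `B ∈ 𝓑`. -/
structure IsCondDerivative {S : Type*} [MeasurableSpace S] (ν : Measure S)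
    (𝓑 : MeasurableSpace S) (f : S → I) (E : S → ProbabilityMeasure I) : Prop where
  measurable : ∀ g : C(I, ℝ), Measurable[𝓑] fun s => ∫ t, g t ∂(E s : Measure I)
  setIntegral_eq : ∀ (g : C(I, ℝ)) (B : Set S), MeasurableSet[𝓑] B →
    ∫ s in B, (∫ t, g t ∂(E s : Measure I)) ∂ν = ∫ s in B, g (f s) ∂ν

/-- `D` is (a version of) the conditional-expectation distance `d*_𝐗 = E(𝐝 | 𝓜 × 𝓜)` of the
ultralimit, where `𝐝` is the ultralimit of the functions `d n : X n × X n → [0,1]`. -/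
def IsUltraDistance {X : ℕ → Type*} [∀ n, MeasurableSpace (X n)] (ω : Ultrafilter ℕ)
    [Nonprincipal ω] (P : ∀ n, Measure (X n)) [∀ n, IsProbabilityMeasure (P n)]
    (d : ∀ n, X n × X n → I) (D : UltraSq ω P → ProbabilityMeasure I) : Prop :=
  IsCondDerivative volume (UltraSq.prodAlgebra ω P) (UltraProd.ulimFun d) D

/-- `Ψ` is a separable realization of the ultralimit of `(X n, P n, d n)` with target `(Y, μ, d*)`:
it is measurable, it pushes the ultralimit measure to `μ`, and it pulls the Borel function `d*`
back to `d*_𝐗` almost everywhere. As `d*_𝐗` is defined up to null sets, this means that versions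
of it exist and each of them agrees with the pull-back almost everywhere. -/
structure IsSeparableRealization {X : ℕ → Type*} [∀ n, MeasurableSpace (X n)] (ω : Ultrafilter ℕ)
    [Nonprincipal ω] (P : ∀ n, Measure (X n)) [∀ n, IsProbabilityMeasure (P n)]
    (d : ∀ n, X n × X n → I) {Y : Type*} [MeasurableSpace Y] (μ : Measure Y)
    (dstar : Kernel (Y × Y) I) (Ψ : UltraProd ω P → Y) : Prop where
  measurable : Measurable Ψ
  map_eq : Measure.map Ψ volume = μ
  exists_distance : ∃ D, IsUltraDistance ω P d D
  pullback_eq : ∀ D, IsUltraDistance ω P d D →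
    ∀ᵐ p : UltraSq ω P, dstar (Ψ p.fst, Ψ p.snd) = (D p : Measure I)

/-! ## Quantum metric measure spaces and their random samples -/

/-- A quantum metric measure space on the standard Borel space `X`. The Borel function `dstar` with
values in the probability measures on `[0,1]` is a Markov kernel; for almost all triples of
different points, independent random lengths satisfy the triangle inequality almost surely. -/
structure QMMSpace (X : Type*) [MeasurableSpace X] [StandardBorelSpace X] where
  μ : Measure X
  [prob : IsProbabilityMeasure μ]
  dstar : Kernel (X × X) I
  [markov : IsMarkovKernel dstar]
  dstar_self : ∀ x, dstar (x, x) = Measure.dirac 0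
  dstar_symm : ∀ x y, dstar (x, y) = dstar (y, x)
  triangle : ∀ᵐ t ∂(μ.prod (μ.prod μ)), t.1 ≠ t.2.1 → t.2.1 ≠ t.2.2 → t.1 ≠ t.2.2 →
    ∀ᵐ l ∂((dstar (t.1, t.2.1)).prod ((dstar (t.2.1, t.2.2)).prod (dstar (t.1, t.2.2)))),
      (l.1 : ℝ) ≤ l.2.1 + l.2.2 ∧ (l.2.1 : ℝ) ≤ l.1 + l.2.2 ∧ (l.2.2 : ℝ) ≤ l.1 + l.2.1

attribute [instance] QMMSpace.prob QMMSpace.markov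

/-- Pairs of indices `i < j`. -/
abbrev Edge : Type := {e : ℕ × ℕ // e.1 < e.2}

namespace QMMSpace

variable {X : Type*} [MeasurableSpace X] [StandardBorelSpace X]

/-- Given the points `x i`, the numbers `d(i,j)`, `i < j`, are independent with laws
`d*(x i, x j)`. -/
def edgeKernel (Q : QMMSpace X) : Kernel (ℕ → X) (Edge → I) where
  toFun x := Measure.infinitePi fun e : Edge => Q.dstar (x e.1.1, x e.1.2)
  measurable' := by
    refine Measurable.measure_of_isPiSystem_of_isProbabilityMeasure
      generateFrom_squareCylinders.symm
      (isPiSystem_squareCylinders (fun _ => MeasurableSpace.isPiSystem_measurableSet) (by simp)) ?_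
    · rintro _ ⟨F, t, ht', rfl⟩
      have ht : ∀ e, MeasurableSet (t e) := fun e => ht' e (mem_univ e)
      simp only [fun x : ℕ → X => Measure.infinitePi_pi
        (fun e : Edge => Q.dstar (x e.1.1, x e.1.2)) (s := F) (t := t) (fun e _ => ht e)]
      refine Finset.measurable_prod _ fun e _ => ?_
      exact (Q.dstar.measurable_coe (ht e)).comp (by fun_prop)

instance (Q : QMMSpace X) : IsMarkovKernel Q.edgeKernel :=
  ⟨fun x => inferInstanceAs (IsProbabilityMeasure
    (Measure.infinitePi fun e : Edge => Q.dstar (x e.1.1, x e.1.2)))⟩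

/-- The law of the random sample: independent `μ`-random points `x 0, x 1, …` and, given them,
independent numbers `d(i,j)`, `i < j`, with laws `d*(x i, x j)`. -/
def sampleLaw (Q : QMMSpace X) : Measure ((ℕ → X) × (Edge → I)) :=
  (Measure.infinitePi fun _ : ℕ => Q.μ) ⊗ₘ Q.edgeKernel

end QMMSpace

/-- The symmetric matrix with zero diagonal and with entries `l (i,j)` for `i < j`. -/
def sampleMatrix (l : Edge → I) (i j : ℕ) : I :=
  if h : i < j then l ⟨(i, j), h⟩ else if h : j < i then l ⟨(j, i), h⟩ else 0

/-- The uniform probability measure on the `n`-th sampled finite space, whose points are the first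
`n + 1` indices. -/
def unif (n : ℕ) : Measure (Fin (n + 1)) := uniformOn Set.univ

instance (n : ℕ) : IsProbabilityMeasure (unif n) :=
  isProbabilityMeasure_uniformOn Set.finite_univ Set.univ_nonempty

/-- The distance on the `n`-th sampled finite space. -/
def sampleDist (l : Edge → I) (n : ℕ) (p : Fin (n + 1) × Fin (n + 1)) : I :=
  sampleMatrix l p.1 p.2

/-- The natural map `i ↦ x i` on the `n`-th sampled finite space. -/
def sampleMap {X : Type*} (x : ℕ → X) (n : ℕ) (i : Fin (n + 1)) : X := x i

end QMM

end

/-! The law of large numbers handles points, and concentration uniform over rectangles handles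
distances. Points: for continuous `f` the function `f ∘ π` is the ultralimit of `f ∘ π_n`, so its
integral is the `ω`-limit of the averages of `f (x_i)`. Almost surely these tend to `∫ f dμ` for a
dense sequence of `f`, hence `π` pushes the ultralimit measure to `μ` (`map_realization_eq`).
Distances: write `E g (x, y) = ∫ g d(d*(x, y))`. A rectangle in `𝓜 × 𝓜` is, up to a null set, the
ultralimit of rectangles `A_n × B_n`, so it suffices to compare the integrals of `g ∘ 𝐝` and `E g ∘
(π × π)` over such ultralimits. There are two obstacles. (1) `A_n` and `B_n` may depend on the
sampled distances, so the average of `g (d(i,j)) - E g (x_i, x_j)` must be small over all `A × B`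
simultaneously. Given the points, Hoeffding bounds each failure by `exp (-c n²)`, which beats the
roughly `4^n` choices of a pair of sets; Borel–Cantelli concludes (`ae_eventually_abs_sum_dev_le`).
(2) `E g` is only Borel, so it does not commute with ultralimits. It is replaced by a continuous `H`
close to it in `L¹(μ × μ)`. The error on the finite spaces is controlled by a law of large numbers
for pairs applied to `|E g - H|` (`ae_tendsto_pair_average`), and on the ultralimit by measure
preservation of `π × π`. A π-λ argument passes from rectangles to `𝓜 × 𝓜`, density passes to all
`g`, and uniqueness of conditional expectations covers every version. -/

namespace QMM

/-! ## Integration on ultralimits -/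

namespace UltraProd

variable {X : ℕ → Type*} [∀ n, MeasurableSpace (X n)] {ω : Ultrafilter ℕ}
  {P : ∀ n, Measure (X n)}

/-- `F` is the pointwise ultralimit of the functions `f n`. -/
def HasUlim {Y : Type*} [TopologicalSpace Y] (f : ∀ n, X n → Y) (F : UltraProd ω P → Y) : Prop :=
  ∀ x, Tendsto (fun n => f n (x n)) ω (𝓝 (F (mk ω P x)))

theorem hasUlim_ulimFun {Y : Type*} [TopologicalSpace Y] [CompactSpace Y] (f : ∀ n, X n → Y) :
    HasUlim f (ulimFun f : UltraProd ω P → Y) :=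
  fun _ => tendsto_ulim ω _

theorem HasUlim.comp_continuous {Y Z : Type*} [TopologicalSpace Y] [TopologicalSpace Z]
    {f : ∀ n, X n → Y} {F : UltraProd ω P → Y} (h : HasUlim f F) {φ : Y → Z}
    (hφ : Continuous φ) : HasUlim (fun n a => φ (f n a)) (fun p => φ (F p)) :=
  fun x => (hφ.tendsto _).comp (h x)

theorem hasUlim_indicator_one (A : ∀ n, Set (X n)) :
    HasUlim (fun n => (A n).indicator (1 : X n → ℝ))
      ((internal ω P A).indicator (1 : UltraProd ω P → ℝ)) := by
  intro x
  by_cases hx : mk ω P x ∈ internal ω P A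
  · rw [indicator_of_mem hx]
    exact tendsto_const_nhds.congr' ((mk_mem_internal.1 hx).mono fun n hn => by
      simp [hn])
  · rw [indicator_of_notMem hx]
    rw [← mem_compl_iff, compl_internal, mk_mem_internal] at hx
    exact tendsto_const_nhds.congr' (hx.mono fun n hn => by
      exact (indicator_of_notMem hn _).symm)

theorem HasUlim.indicator {f : ∀ n, X n → ℝ} {F : UltraProd ω P → ℝ} (h : HasUlim f F)
    (A : ∀ n, Set (X n)) :
    HasUlim (fun n => (A n).indicator (f n)) ((internal ω P A).indicator F) := by
  intro x
  have := (hasUlim_indicator_one (P := P) A x).mul (h x)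
  simpa only [← indicator_mul_left, Pi.one_apply, one_mul] using this

theorem approx_internal {A : ∀ n, Set (X n)} (hA : ∀ n, MeasurableSet (A n)) :
    Approx A (internal ω P A) :=
  ⟨hA, by rw [symmDiff_self]; exact isNull_empty⟩

section

variable [∀ n, IsProbabilityMeasure (P n)] [Nonprincipal ω]

theorem measurableSet_internal {A : ∀ n, Set (X n)} (hA : ∀ n, MeasurableSet (A n)) :
    MeasurableSet (internal ω P A) := ⟨A, approx_internal hA⟩

theorem volume_internal {A : ∀ n, Set (X n)} (hA : ∀ n, MeasurableSet (A n)) :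
    volume (internal ω P A) = content ω P A := volume_eq (approx_internal hA)

instance : IsProbabilityMeasure (volume : Measure (UltraProd ω P)) where
  measure_univ := by
    have h : internal ω P (fun _ => univ) = univ := by
      ext q
      obtain ⟨x, rfl⟩ := mk_surj q
      simp [mk_mem_internal]
    rw [← h, volume_internal fun _ => .univ]
    refine tendsto_nhds_unique (tendsto_content _) ?_
    simp

theorem IsNull.volume_eq_zero {N : Set (UltraProd ω P)} (h : IsNull N) : volume N = 0 := by
  have : Approx (fun _ => ∅) N := ⟨fun _ => .empty, by
    rw [internal_empty]
    exact h.mono (by simp [symmDiff_def])⟩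
  rw [volume_eq this, content_empty]

theorem Approx.ae_eq {A : ∀ n, Set (X n)} {M : Set (UltraProd ω P)} (h : Approx A M) :
    internal ω P A =ᵐ[volume] M :=
  measure_symmDiff_eq_zero_iff.1 h.2.volume_eq_zero

/-- An open `U` is exhausted by the open sets `V k` of points farther than `1/(k+1)` from its
complement. Openness of `V k` places a limit point in an ultralimit of preimages, and the positive
margin survives the limit in the other direction. So the preimage of `U` is a countable union of
ultralimit sets. -/
theorem HasUlim.measurable {Y : Type*} [PseudoEMetricSpace Y] [MeasurableSpace Y] [BorelSpace Y]
    {f : ∀ n, X n → Y} {F : UltraProd ω P → Y} (h : HasUlim f F) (hf : ∀ n, Measurable (f n)) :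
    Measurable F := by
  refine measurable_of_isOpen fun U hU => ?_
  let V : ℕ → Set Y := fun k => {y | ((k : ℝ≥0∞) + 1)⁻¹ < Metric.infEDist y Uᶜ}
  have hV : ∀ k, IsOpen (V k) := fun k => isOpen_lt continuous_const Metric.continuous_infEDist
  have key : F ⁻¹' U = ⋃ k, internal ω P fun n => f n ⁻¹' V k := by
    ext q
    obtain ⟨x, rfl⟩ := mk_surj q
    simp only [mem_preimage, mem_iUnion, mk_mem_internal]
    constructor
    · intro hq
      have hpos : 0 < Metric.infEDist (F (mk ω P x)) Uᶜ := by
        rw [pos_iff_ne_zero, Ne, ← Metric.mem_iff_infEDist_zero_of_closed hU.isClosed_compl]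
        exact fun h' => h' hq
      obtain ⟨k, hk⟩ := ENNReal.exists_inv_nat_lt hpos.ne'
      refine ⟨k, (h x).eventually ((hV k).mem_nhds ?_)⟩
      exact lt_of_le_of_lt (ENNReal.inv_le_inv.2 le_self_add) hk
    · rintro ⟨k, hk⟩
      by_contra hq
      have h0 : Tendsto (fun n => Metric.infEDist (f n (x n)) Uᶜ) ω (𝓝 0) := by
        have := (Metric.continuous_infEDist (s := Uᶜ).tendsto _).comp (h x)
        rwa [Metric.infEDist_zero_of_mem hq] at this
      have := ge_of_tendsto h0 (hk.mono fun n hn => le_of_lt hn)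
      simp at this
  rw [key]
  exact .iUnion fun k => measurableSet_internal fun n => hf n (hV k).measurableSet

theorem tendsto_measureReal_internal {A : ∀ n, Set (X n)} (hA : ∀ n, MeasurableSet (A n)) :
    Tendsto (fun n => (P n).real (A n)) ω
      (𝓝 ((volume : Measure (UltraProd ω P)).real (internal ω P A))) := by
  have h := tendsto_content (ω := ω) (P := P) A
  rw [← volume_internal hA] at h
  exact (ENNReal.tendsto_toReal (measure_ne_top _ _)).comp h

/-- Integrals of uniformly bounded functions converge to the integral of the ultralimit. -/
theorem HasUlim.tendsto_integral {f : ∀ n, X n → ℝ} {F : UltraProd ω P → ℝ} (h : HasUlim f F)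
    (hf : ∀ n, Measurable (f n)) {C : ℝ} (hC : ∀ n a, |f n a| ≤ C) :
    Tendsto (fun n => ∫ a, f n a ∂(P n)) ω (𝓝 (∫ p, F p)) := by
  have hFm : Measurable F := h.measurable hf
  have hFC : ∀ p, |F p| ≤ C := by
    intro p
    obtain ⟨x, rfl⟩ := mk_surj p
    exact le_of_tendsto' (h x).abs fun n => hC n _
  have hfi : ∀ n, Integrable (f n) (P n) := fun n =>
    .of_bound (hf n).aestronglyMeasurable C (.of_forall (hC n))
  have hFi : Integrable F := .of_bound hFm.aestronglyMeasurable C (.of_forall hFC)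
  rw [Metric.tendsto_nhds]
  intro ε hε
  -- Three errors of at most `δ` are added at the end: rounding on `X n`, convergence for step
  -- functions, rounding on the ultralimit.
  set δ : ℝ := ε / 4 with hδ
  have hδ0 : 0 < δ := by positivity
  let V : Finset ℤ := Finset.Icc ⌊-C / δ⌋ ⌊C / δ⌋
  let A : ℤ → ∀ n, Set (X n) := fun v n => {a | ⌊f n a / δ⌋ = v}
  have hA : ∀ v n, MeasurableSet (A v n) := fun v n =>
    (Int.measurable_floor.comp ((hf n).div_const δ)) (measurableSet_singleton v)
  let s : ∀ n, X n → ℝ := fun n a => ∑ v ∈ V, δ * v * (A v n).indicator 1 a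
  -- The pieces are ultralimits of the level sets of the `f n`, not level sets of `F`, since
  -- rounding is discontinuous. The bound on `S - F` is inherited from the finite spaces by taking
  -- limits.
  let S : UltraProd ω P → ℝ := fun p => ∑ v ∈ V, δ * v * (internal ω P (A v)).indicator 1 p
  have hs : ∀ n a, |s n a - f n a| ≤ δ := by
    intro n a
    have hmem : ⌊f n a / δ⌋ ∈ V := by
      obtain ⟨h1, h2⟩ := abs_le.1 (hC n a)
      exact Finset.mem_Icc.2 ⟨Int.floor_mono (by gcongr), Int.floor_mono (by gcongr)⟩
    have : s n a = δ * ⌊f n a / δ⌋ := by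
      simp only [s]
      rw [Finset.sum_eq_single_of_mem _ hmem]
      · simp [A]
      · intro v _ hv
        simp [A, hv.symm]
    rw [this]
    have h1 := Int.floor_le (f n a / δ)
    have h2 := (Int.lt_floor_add_one (f n a / δ)).le
    have h3 : f n a = δ * (f n a / δ) := by field_simp
    rw [abs_le]
    constructor <;> nlinarith
  have hS : HasUlim s S := fun x =>
    tendsto_finsetSum _ fun v _ => (hasUlim_indicator_one (A v) x).const_mul _
  have hSF : ∀ p, |S p - F p| ≤ δ := by
    intro p
    obtain ⟨x, rfl⟩ := mk_surj p
    exact le_of_tendsto' ((hS x).sub (h x)).abs fun n => hs n _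
  have hsv : ∀ v n, Integrable (fun a => δ * v * (A v n).indicator (1 : X n → ℝ) a) (P n) :=
    fun v n => ((integrable_const (1 : ℝ)).indicator (hA v n)).const_mul _
  have hSv : ∀ v, Integrable
      (fun p => δ * v * (internal ω P (A v)).indicator (1 : UltraProd ω P → ℝ) p) :=
    fun v => ((integrable_const (1 : ℝ)).indicator (measurableSet_internal (hA v))).const_mul _
  have hsi : ∀ n, Integrable (s n) (P n) := fun n => integrable_finsetSum _ fun v _ => hsv v n
  have hSi : Integrable S := integrable_finsetSum _ fun v _ => hSv v
  have hint : ∀ n, ∫ a, s n a ∂(P n) = ∑ v ∈ V, δ * v * (P n).real (A v n) := by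
    intro n
    simp only [s]
    rw [integral_finsetSum V (fun v _ => hsv v n)]
    refine Finset.sum_congr rfl fun v _ => ?_
    rw [integral_const_mul, integral_indicator_one (hA v n)]
  have hInt : ∫ p, S p = ∑ v ∈ V, δ * v * volume.real (internal ω P (A v)) := by
    simp only [S]
    rw [integral_finsetSum V (fun v _ => hSv v)]
    refine Finset.sum_congr rfl fun v _ => ?_
    rw [integral_const_mul, integral_indicator_one (measurableSet_internal (hA v))]
  have hlim : Tendsto (fun n => ∫ a, s n a ∂(P n)) ω (𝓝 (∫ p, S p)) := by
    simp only [hint, hInt]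
    exact tendsto_finsetSum _ fun v _ => (tendsto_measureReal_internal (hA v)).const_mul _
  have close : ∀ {Y : Type _} [MeasurableSpace Y] (ν : Measure Y) [IsProbabilityMeasure ν]
      (a b : Y → ℝ), Integrable a ν → Integrable b ν → (∀ y, |a y - b y| ≤ δ) →
      |∫ y, a y ∂ν - ∫ y, b y ∂ν| ≤ δ := by
    intro Y _ ν _ a b ha hb hab
    rw [← integral_sub ha hb]
    simpa using norm_integral_le_of_norm_le_const (μ := ν) (f := fun y => a y - b y) (.of_forall hab)
  filter_upwards [Metric.tendsto_nhds.1 hlim δ hδ0] with n hn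
  rw [Real.dist_eq] at hn ⊢
  have h1 := abs_le.1 (close (P n) _ _ (hsi n) (hfi n) (hs n))
  have h2 := abs_le.1 (close _ _ _ hSi hFi hSF)
  have h3 := abs_lt.1 hn
  rw [abs_lt]
  constructor <;> linarith [h1.1, h1.2, h2.1, h2.2, h3.1, h3.2]

theorem HasUlim.tendsto_setIntegral {f : ∀ n, X n → ℝ} {F : UltraProd ω P → ℝ} (h : HasUlim f F)
    (hf : ∀ n, Measurable (f n)) {C : ℝ} (hC : ∀ n a, |f n a| ≤ C)
    {A : ∀ n, Set (X n)} (hA : ∀ n, MeasurableSet (A n)) :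
    Tendsto (fun n => ∫ a in A n, f n a ∂(P n)) ω (𝓝 (∫ p in internal ω P A, F p)) := by
  simp only [← integral_indicator (measurableSet_internal (P := P) (ω := ω) hA),
    ← fun n => integral_indicator (μ := P n) (f := f n) (hA n)]
  refine (h.indicator A).tendsto_integral (fun n => (hf n).indicator (hA n)) (C := C) fun n a => ?_
  by_cases ha : a ∈ A n
  · rw [indicator_of_mem ha]; exact hC n a
  · rw [indicator_of_notMem ha, abs_zero]; exact (abs_nonneg _).trans (hC n a)

end

end UltraProd

/-! ## The square of an ultralimit -/

namespace UltraSq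

open UltraProd

variable {X : ℕ → Type*} [∀ n, MeasurableSpace (X n)] {ω : Ultrafilter ℕ}
  {P : ∀ n, Measure (X n)}

theorem preimage_fst_internal (A : ∀ n, Set (X n)) :
    (fst ⁻¹' internal ω P A : Set (UltraSq ω P)) = internal ω _ fun n => A n ×ˢ univ := by
  ext q
  obtain ⟨x, rfl⟩ := mk_surj q
  rw [mk_mem_internal]
  change mk ω P (fun n => (x n).1) ∈ internal ω P A ↔ _
  simp [mk_mem_internal]

theorem preimage_snd_internal (A : ∀ n, Set (X n)) :
    (snd ⁻¹' internal ω P A : Set (UltraSq ω P)) = internal ω _ fun n => univ ×ˢ A n := by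
  ext q
  obtain ⟨x, rfl⟩ := mk_surj q
  rw [mk_mem_internal]
  change mk ω P (fun n => (x n).2) ∈ internal ω P A ↔ _
  simp [mk_mem_internal]

variable [∀ n, IsProbabilityMeasure (P n)]

theorem isNull_preimage_fst {N : Set (UltraProd ω P)} (h : IsNull N) :
    IsNull (fst ⁻¹' N : Set (UltraSq ω P)) := by
  intro ε hε
  obtain ⟨A, hA, hN, hc⟩ := h ε hε
  refine ⟨fun n => A n ×ˢ univ, fun n => (hA n).prod .univ, ?_, ?_⟩
  · rw [← preimage_fst_internal]; exact preimage_mono hN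
  · simpa [content, Measure.prod_prod] using hc

theorem isNull_preimage_snd {N : Set (UltraProd ω P)} (h : IsNull N) :
    IsNull (snd ⁻¹' N : Set (UltraSq ω P)) := by
  intro ε hε
  obtain ⟨A, hA, hN, hc⟩ := h ε hε
  refine ⟨fun n => univ ×ˢ A n, fun n => MeasurableSet.univ.prod (hA n), ?_, ?_⟩
  · rw [← preimage_snd_internal]; exact preimage_mono hN
  · simpa [content, Measure.prod_prod] using hc

theorem approx_preimage_fst {A : ∀ n, Set (X n)} {M : Set (UltraProd ω P)} (h : Approx A M) :
    Approx (fun n => A n ×ˢ univ) (fst ⁻¹' M : Set (UltraSq ω P)) := by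
  refine ⟨fun n => (h.1 n).prod .univ, ?_⟩
  rw [← preimage_fst_internal]
  exact isNull_preimage_fst h.2

theorem approx_preimage_snd {A : ∀ n, Set (X n)} {M : Set (UltraProd ω P)} (h : Approx A M) :
    Approx (fun n => univ ×ˢ A n) (snd ⁻¹' M : Set (UltraSq ω P)) := by
  refine ⟨fun n => MeasurableSet.univ.prod (h.1 n), ?_⟩
  rw [← preimage_snd_internal]
  exact isNull_preimage_snd h.2

variable [Nonprincipal ω]

theorem measurable_fst : Measurable (fst : UltraSq ω P → UltraProd ω P) :=
  fun _ ⟨_, h⟩ => ⟨_, approx_preimage_fst h⟩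

theorem measurable_snd : Measurable (snd : UltraSq ω P → UltraProd ω P) :=
  fun _ ⟨_, h⟩ => ⟨_, approx_preimage_snd h⟩

theorem prodAlgebra_le :
    prodAlgebra ω P ≤ (inferInstance : MeasurableSpace (UltraSq ω P)) :=
  sup_le measurable_fst.comap_le measurable_snd.comap_le

/-- This lets integrals over rectangles of `𝓜 × 𝓜` be computed as limits over rectangles of the
spaces `X n × X n`. -/
theorem internal_prod_ae_eq {A B : ∀ n, Set (X n)} {M N : Set (UltraProd ω P)}
    (hA : Approx A M) (hB : Approx B N) :
    internal ω (fun n => (P n).prod (P n)) (fun n => A n ×ˢ B n) =ᵐ[volume]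
      (fst ⁻¹' M ∩ snd ⁻¹' N : Set (UltraSq ω P)) := by
  have h : (fun n => A n ×ˢ B n) = fun n => (A n ×ˢ univ) ∩ (univ ×ˢ B n) := by
    funext n
    simp [prod_inter_prod]
  rw [h, internal_inter]
  exact (approx_preimage_fst hA).ae_eq.inter (approx_preimage_snd hB).ae_eq

/-- The measure of the square projects to the product measure. -/
theorem measurePreserving_fst_snd :
    MeasurePreserving (fun p : UltraSq ω P => (p.fst, p.snd)) volume (volume.prod volume) := by
  have hm : Measurable fun p : UltraSq ω P => (p.fst, p.snd) :=
    measurable_fst.prodMk measurable_snd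
  refine ⟨hm, (Measure.prod_eq fun M N hM hN => ?_).symm⟩
  rw [Measure.map_apply hm (hM.prod hN)]
  obtain ⟨A, hA⟩ := exists_approx hM
  obtain ⟨B, hB⟩ := exists_approx hN
  change volume (fst ⁻¹' M ∩ snd ⁻¹' N : Set (UltraSq ω P)) = _
  rw [← measure_congr (internal_prod_ae_eq hA hB), volume_eq hA, volume_eq hB,
    volume_internal fun n => (hA.1 n).prod (hB.1 n)]
  refine tendsto_nhds_unique (tendsto_content _) ?_
  simp only [Measure.prod_prod]
  refine ENNReal.Tendsto.mul (tendsto_content A) (.inr ?_) (tendsto_content B) (.inr ?_)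
  · exact ne_top_of_le_ne_top ENNReal.one_ne_top (content_le_one _)
  · exact ne_top_of_le_ne_top ENNReal.one_ne_top (content_le_one _)

end UltraSq

/-! ## Concentration for independent coordinates -/

theorem ae_eventually_notMem_of_summable {Ω : Type*} [MeasurableSpace Ω] {ν : Measure Ω}
    {S : ℕ → Set Ω} {b : ℕ → ℝ} (hS : ∀ n, ν (S n) ≤ ENNReal.ofReal (b n)) (hb : Summable b) :
    ∀ᵐ x ∂ν, ∀ᶠ n in atTop, x ∉ S n :=
  ae_eventually_notMem (ne_top_of_le_ne_top hb.tsum_ofReal_ne_top (ENNReal.tsum_le_tsum hS))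

/-- Hoeffding's inequality for functions of the coordinates of a product measure. -/
theorem infinitePi_le_abs_sum_le {ι : Type*} {Ω : ι → Type*} [∀ i, MeasurableSpace (Ω i)]
    (ν : ∀ i, Measure (Ω i)) [∀ i, IsProbabilityMeasure (ν i)] {h : ∀ i, Ω i → ℝ}
    (hm : ∀ i, Measurable (h i)) {C : ℝ} (hC0 : 0 < C)
    (hC : ∀ i a, |h i a| ≤ C) (h0 : ∀ i, ∫ a, h i a ∂(ν i) = 0) (s : Finset ι) {M : ℝ}
    (hsM : s.card * C ^ 2 ≤ M) {t : ℝ} (ht : 0 ≤ t) :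
    Measure.infinitePi ν {x | t ≤ |∑ i ∈ s, h i (x i)|} ≤
      ENNReal.ofReal (2 * Real.exp (-t ^ 2 / (2 * M))) := by
  -- The final comparison of exponents divides by `s.card * C ^ 2`, which must be positive.
  rcases s.eq_empty_or_nonempty with rfl | hs
  · rcases ht.eq_or_lt with rfl | ht
    · refine prob_le_one.trans ?_
      simp
    · simp [not_le.2 ht]
  have one : ∀ {f : ∀ i, Ω i → ℝ}, (∀ i, Measurable (f i)) → (∀ i a, |f i a| ≤ C) →
      (∀ i, ∫ a, f i a ∂(ν i) = 0) →
      (Measure.infinitePi ν).real {x | t ≤ ∑ i ∈ s, f i (x i)} ≤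
        Real.exp (-t ^ 2 / (2 * M)) := by
    intro f hfm hfC hf0
    have hsub : ∀ i, HasSubgaussianMGF (fun x : ∀ i, Ω i => f i (x i))
        ((‖C - -C‖₊ / 2) ^ 2) (Measure.infinitePi ν) := by
      intro i
      have hp := measurePreserving_eval_infinitePi ν i
      refine hasSubgaussianMGF_of_mem_Icc_of_integral_eq_zero
        ((hfm i).comp (measurable_pi_apply i)).aemeasurable
        (.of_forall fun x => abs_le.1 (hfC i (x i))) ?_
      rw [← hf0 i, ← hp.map_eq]
      exact (integral_map hp.measurable.aemeasurable (hfm i).aestronglyMeasurable).symm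
    refine (HasSubgaussianMGF.measure_sum_ge_le_of_iIndepFun (iIndepFun_infinitePi hfm)
      (fun i _ => hsub i) ht).trans ?_
    have hcard : (0 : ℝ) < s.card := by exact_mod_cast hs.card_pos
    have hsum : ((∑ _i ∈ s, (‖C - -C‖₊ / 2) ^ 2 : NNReal) : ℝ) = s.card * C ^ 2 := by
      simp only [Finset.sum_const, nsmul_eq_mul, NNReal.coe_mul, NNReal.coe_natCast,
        NNReal.coe_pow, NNReal.coe_div, coe_nnnorm, Real.norm_eq_abs, NNReal.coe_ofNat]
      rw [sub_neg_eq_add, ← two_mul, abs_of_pos (by positivity), mul_div_cancel_left₀ _ two_ne_zero]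
    rw [hsum]
    gcongr Real.exp ?_
    rw [neg_div, neg_div, neg_le_neg_iff]
    gcongr
  have hneg := one (f := fun i a => -h i a) (fun i => (hm i).neg) (fun i a => by
    rw [abs_neg]; exact hC i a) (fun i => by rw [integral_neg, h0, neg_zero])
  have hpos := one hm hC h0
  have hsub : {x : ∀ i, Ω i | t ≤ |∑ i ∈ s, h i (x i)|} ⊆
      {x | t ≤ ∑ i ∈ s, h i (x i)} ∪ {x | t ≤ ∑ i ∈ s, -h i (x i)} := by
    intro x hx
    simp only [mem_union, mem_ofPred_eq, Finset.sum_neg_distrib] at hx ⊢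
    exact le_abs.1 hx
  rw [← ofReal_measureReal]
  refine ENNReal.ofReal_le_ofReal ?_
  have := (measureReal_mono (μ := Measure.infinitePi ν) hsub).trans (measureReal_union_le _ _)
  linarith

/-- Resampling one coordinate preserves the law of an independent sequence. -/
theorem measurePreserving_update {X : Type*} [MeasurableSpace X] (μ : Measure X)
    [IsProbabilityMeasure μ] (j : ℕ) :
    MeasurePreserving (fun p : X × (ℕ → X) => Function.update p.2 j p.1)
      (μ.prod (Measure.infinitePi fun _ => μ)) (Measure.infinitePi fun _ => μ) := by
  have hm : Measurable fun p : X × (ℕ → X) => Function.update p.2 j p.1 := by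
    refine measurable_pi_iff.2 fun i => ?_
    by_cases hi : i = j
    · subst hi
      simpa using measurable_fst
    · simp only [Function.update_of_ne hi]
      fun_prop
  refine ⟨hm, Measure.eq_infinitePi _ fun s t ht => ?_⟩
  rw [Measure.map_apply hm (.pi s.countable_toSet fun i _ => ht i)]
  by_cases hj : j ∈ s
  · have : (fun p : X × (ℕ → X) => Function.update p.2 j p.1) ⁻¹' ((s : Set ℕ).pi t) =
        t j ×ˢ ((s.erase j : Finset ℕ) : Set ℕ).pi t := by
      ext p
      simp only [mem_preimage, Set.mem_pi, mem_prod, Finset.mem_coe, Finset.mem_erase]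
      constructor
      · refine fun h => ⟨by simpa using h j hj, fun i hi => ?_⟩
        simpa [Function.update_of_ne hi.1] using h i hi.2
      · rintro ⟨h1, h2⟩ i hi
        by_cases hij : i = j
        · subst hij; simpa using h1
        · simpa [Function.update_of_ne hij] using h2 i ⟨hij, hi⟩
    rw [this, Measure.prod_prod, Measure.infinitePi_pi _ fun i _ => ht i,
      Finset.mul_prod_erase s (fun i => μ (t i)) hj]
  · have : (fun p : X × (ℕ → X) => Function.update p.2 j p.1) ⁻¹' ((s : Set ℕ).pi t) =
        univ ×ˢ (s : Set ℕ).pi t := by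
      ext p
      simp only [mem_preimage, Set.mem_pi, mem_prod, Finset.mem_coe, mem_univ, true_and]
      refine forall₂_congr fun i hi => ?_
      rw [Function.update_of_ne (ne_of_mem_of_not_mem hi hj)]
    rw [this, Measure.prod_prod, Measure.infinitePi_pi _ fun i _ => ht i, measure_univ, one_mul]

/-! ## Laws of large numbers -/

theorem ae_tendsto_average {X : Type*} [MeasurableSpace X] (μ : Measure X)
    [IsProbabilityMeasure μ] {f : X → ℝ} (hf : Measurable f) (hfi : Integrable f μ) :
    ∀ᵐ x ∂(Measure.infinitePi fun _ : ℕ => μ),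
      Tendsto (fun n : ℕ => (∑ i ∈ Finset.range (n + 1), f (x i)) / ((n : ℝ) + 1)) atTop
        (𝓝 (∫ a, f a ∂μ)) := by
  have hp := fun i => measurePreserving_eval_infinitePi (fun _ : ℕ => μ) i
  have hmap : ∀ i : ℕ, Measure.map (fun x : ℕ → X => f (x i)) (Measure.infinitePi fun _ => μ) =
      Measure.map f μ := fun i => by
    conv_rhs => rw [← (hp i).map_eq, Measure.map_map hf (hp i).measurable]
    rfl
  have h := strong_law_ae_real (μ := Measure.infinitePi fun _ : ℕ => μ)
    (fun i x => f (x i)) ((hp 0).integrable_comp_of_integrable hfi)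
    (fun i j hij => (iIndepFun_infinitePi fun _ => hf).indepFun hij)
    (fun i => ⟨(hf.comp (measurable_pi_apply i)).aemeasurable,
      (hf.comp (measurable_pi_apply 0)).aemeasurable, by rw [hmap, hmap]⟩)
  have h0 : ∫ x : ℕ → X, f (x 0) ∂(Measure.infinitePi fun _ => μ) = ∫ a, f a ∂μ := by
    conv_rhs => rw [← (hp 0).map_eq]
    exact (integral_map (hp 0).measurable.aemeasurable hf.aestronglyMeasurable).symm
  filter_upwards [h] with x hx
  rw [h0] at hx
  simpa using (tendsto_add_atTop_iff_nat 1).2 hx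

/-- The strong law of large numbers for averages over all pairs of sample points. -/
theorem ae_tendsto_pair_average {X : Type*} [MeasurableSpace X] (μ : Measure X)
    [IsProbabilityMeasure μ] {K : X × X → ℝ} (hK : Measurable K) {C : ℝ} (hC : ∀ p, |K p| ≤ C) :
    ∀ᵐ x ∂(Measure.infinitePi fun _ : ℕ => μ),
      Tendsto (fun n : ℕ => (∑ i ∈ Finset.range (n + 1), ∑ j ∈ Finset.range (n + 1),
        K (x i, x j)) / ((n : ℝ) + 1) ^ 2) atTop (𝓝 (∫ p, K p ∂(μ.prod μ))) := by
  -- Conditionally on `x j`, the numbers `K (x i, x j) - c (x j)` with `i ≠ j` are independent and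
  -- centred. The double average thus reduces to an ordinary average of `c (x j)`, plus column
  -- errors.
  set c : X → ℝ := fun y => ∫ z, K (z, y) ∂μ with hc
  have hcm : Measurable c := (hK.stronglyMeasurable.integral_prod_left').measurable
  have hKi : ∀ y, Integrable (fun z => K (z, y)) μ := fun y =>
    .of_bound (hK.comp measurable_prodMk_right).aestronglyMeasurable C (.of_forall fun z => hC _)
  have hC0 : 0 ≤ C := by
    obtain ⟨x⟩ := μ.nonempty_of_neZero
    exact (abs_nonneg _).trans (hC (x, x))
  have hcC : ∀ y, |c y| ≤ C := fun y => by
    simpa using norm_integral_le_of_norm_le_const (μ := μ) (f := fun z => K (z, y))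
      (.of_forall fun z => hC (z, y))
  have hd : ∀ z y, |K (z, y) - c y| ≤ 2 * C := fun z y =>
    (abs_sub _ _).trans (by linarith [hC (z, y), hcC y])
  -- The diagonal term is left out because it depends on `x j` alone; it is restored later at a cost
  -- of at most `2 * C` per column.
  let S : ℝ → ℕ → ℕ → Set (ℕ → X) := fun ε n j =>
    {x | ε * (n + 1) ≤ |∑ i ∈ (Finset.range (n + 1)).erase j, (K (x i, x j) - c (x j))|}
  have hSm : ∀ ε n j, MeasurableSet (S ε n j) := fun ε n j =>
    measurableSet_le (by fun_prop) (by fun_prop)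
  -- Hoeffding's exponent for deviation `ε (n+1)` of at most `n+1` terms bounded by `2 * C + 1`; the
  -- added `1` keeps the bound positive when `C = 0`.
  let r : ℝ → ℝ := fun ε => ε ^ 2 / (2 * (2 * C + 1) ^ 2)
  have hS : ∀ ε, 0 < ε → ∀ n j, (Measure.infinitePi fun _ : ℕ => μ) (S ε n j) ≤
      ENNReal.ofReal (2 * Real.exp (-r ε * ((n : ℝ) + 1))) := by
    intro ε hε n j
    have hp := measurePreserving_update μ j
    -- Replacing `x j` by an independent copy `y` keeps the law. Fubini then freezes `y`, which
    -- leaves a sum of independent variables.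
    rw [← hp.measure_preimage (hSm ε n j).nullMeasurableSet,
      Measure.prod_apply (hp.measurable (hSm ε n j))]
    have key : ∀ y, (Measure.infinitePi fun _ : ℕ => μ)
        (Prod.mk y ⁻¹' ((fun p : X × (ℕ → X) => Function.update p.2 j p.1) ⁻¹' S ε n j)) ≤
        ENNReal.ofReal (2 * Real.exp (-r ε * ((n : ℝ) + 1))) := by
      intro y
      have h1 := infinitePi_le_abs_sum_le (fun _ : ℕ => μ) (h := fun _ z => K (z, y) - c y)
        (fun _ => by fun_prop) (C := 2 * C + 1) (by positivity)
        (fun _ z => (hd z y).trans (by linarith))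
        (fun _ => by rw [integral_sub (hKi y) (integrable_const _)]; simp [hc])
        ((Finset.range (n + 1)).erase j) (M := ((n : ℝ) + 1) * (2 * C + 1) ^ 2)
        (by
          have : (((Finset.range (n + 1)).erase j).card : ℝ) ≤ (n : ℝ) + 1 := by
            exact_mod_cast (Finset.card_erase_le).trans (Finset.card_range _).le
          gcongr)
        (t := ε * (n + 1)) (by positivity)
      convert h1 using 2
      · ext x
        simp only [S, mem_preimage, mem_ofPred_eq]
        rw [Finset.sum_congr rfl fun i hi => ?_]
        rw [Function.update_self, Function.update_of_ne (Finset.ne_of_mem_erase hi)]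
      · simp only [r]
        congr 2
        field_simp
    calc _ ≤ ∫⁻ _, ENNReal.ofReal (2 * Real.exp (-r ε * ((n : ℝ) + 1))) ∂μ :=
          lintegral_mono key
      _ = _ := by simp
  have hbad : ∀ ε, 0 < ε → ∀ᵐ x ∂(Measure.infinitePi fun _ : ℕ => μ), ∀ᶠ n in atTop,
      x ∉ ⋃ j ∈ Finset.range (n + 1), S ε n j := by
    intro ε hε
    have hr : 0 < r ε := by positivity
    refine ae_eventually_notMem_of_summable
      (b := fun n => ((n : ℝ) + 1) * (2 * Real.exp (-r ε * ((n : ℝ) + 1)))) (fun n => ?_) ?_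
    · refine (measure_biUnion_finset_le _ _).trans
        ((Finset.sum_le_sum fun j _ => hS ε hε n j).trans ?_)
      rw [Finset.sum_const, Finset.card_range, ← ENNReal.ofReal_nsmul, nsmul_eq_mul]
      simp
    · have := ((summable_nat_add_iff 1).2 (Real.summable_pow_mul_exp_neg_nat_mul 1 hr)).mul_left 2
      refine this.congr fun n => ?_
      push_cast
      ring
  have hall := ae_all_iff.2 fun k : ℕ => hbad (1 / ((k : ℝ) + 1)) (by positivity)
  have hci : Integrable c μ := .of_bound hcm.aestronglyMeasurable C (.of_forall hcC)
  have hint : ∫ y, c y ∂μ = ∫ p, K p ∂(μ.prod μ) :=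
    (integral_prod_symm K (.of_bound hK.aestronglyMeasurable C (.of_forall hC))).symm
  filter_upwards [hall, ae_tendsto_average μ hcm hci] with x hx hcx
  rw [hint] at hcx
  have hdiff : Tendsto (fun n : ℕ => (∑ i ∈ Finset.range (n + 1), ∑ j ∈ Finset.range (n + 1),
      (K (x i, x j) - c (x j))) / ((n : ℝ) + 1) ^ 2) atTop (𝓝 0) := by
    rw [Metric.tendsto_nhds]
    intro δ hδ
    obtain ⟨k, hk⟩ := exists_nat_one_div_lt (half_pos hδ)
    have hlim : Tendsto (fun n : ℕ => 2 * C * (1 / ((n : ℝ) + 1))) atTop (𝓝 0) := by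
      simpa using tendsto_one_div_add_atTop_nhds_zero_nat.const_mul (2 * C)
    -- Half of `δ` pays for the off-diagonal sums, the other half for the diagonal.
    filter_upwards [hx k, hlim.eventually_lt_const (half_pos hδ)] with n hn hn'
    have hrow : ∀ j ∈ Finset.range (n + 1),
        |∑ i ∈ Finset.range (n + 1), (K (x i, x j) - c (x j))| ≤
          1 / ((k : ℝ) + 1) * (n + 1) + 2 * C := by
      intro j hj
      have h1 : x ∉ S (1 / ((k : ℝ) + 1)) n j := fun h => hn (mem_biUnion hj h)
      simp only [S, mem_ofPred_eq, not_le] at h1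
      rw [← Finset.add_sum_erase _ _ hj]
      refine (abs_add_le _ _).trans ?_
      linarith [hd (x j) (x j)]
    rw [Real.dist_eq, sub_zero, Finset.sum_comm, abs_div, abs_of_pos (by positivity : (0 : ℝ) <
      ((n : ℝ) + 1) ^ 2), div_lt_iff₀ (by positivity)]
    calc _ ≤ ∑ j ∈ Finset.range (n + 1), (1 / ((k : ℝ) + 1) * (n + 1) + 2 * C) :=
          (Finset.abs_sum_le_sum_abs _ _).trans (Finset.sum_le_sum hrow)
      _ = (1 / ((k : ℝ) + 1) + 2 * C * (1 / ((n : ℝ) + 1))) * ((n : ℝ) + 1) ^ 2 := by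
          rw [Finset.sum_const, Finset.card_range, nsmul_eq_mul]
          push_cast
          field_simp
      _ < δ * ((n : ℝ) + 1) ^ 2 := by
          gcongr
          linarith
  have := hdiff.add hcx
  rw [zero_add] at this
  refine this.congr fun n => ?_
  simp only [Finset.sum_sub_distrib, Finset.sum_const, Finset.card_range, nsmul_eq_mul]
  push_cast
  field_simp
  ring

/-! ## Cut-norm concentration of the sampled distances -/

/-- The factor `4^n` counts pairs of index sets. Since `2 ≤ e`, the term is at most `exp (2n - r
n²)`, and completing the square gives `3n - r n² ≤ 9/(4r)`, leaving a geometric majorant. -/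
theorem summable_four_pow_mul_exp_neg_sq {r : ℝ} (hr : 0 < r) :
    Summable fun n : ℕ => (2 : ℝ) ^ n * 2 ^ n * Real.exp (-r * (n : ℝ) ^ 2) := by
  have h2 : (2 : ℝ) ≤ Real.exp 1 := by linarith [Real.add_one_le_exp (1 : ℝ)]
  refine Summable.of_nonneg_of_le (fun n => by positivity) (fun n => ?_)
    (Real.summable_exp_neg_nat.mul_left (Real.exp (9 / (4 * r))))
  calc (2 : ℝ) ^ n * 2 ^ n * Real.exp (-r * (n : ℝ) ^ 2)
      ≤ Real.exp 1 ^ n * Real.exp 1 ^ n * Real.exp (-r * (n : ℝ) ^ 2) := by gcongr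
    _ = Real.exp (2 * n - r * (n : ℝ) ^ 2) := by
        rw [← Real.exp_nat_mul, ← Real.exp_add, ← Real.exp_add]
        ring_nf
    _ ≤ Real.exp (9 / (4 * r) + -(n : ℝ)) := by
        gcongr
        have : 9 / (4 * r) + -(n : ℝ) - (2 * n - r * (n : ℝ) ^ 2) =
            r * ((n : ℝ) - 3 / (2 * r)) ^ 2 := by
          field_simp
          ring
        have h0 : 0 ≤ r * ((n : ℝ) - 3 / (2 * r)) ^ 2 := by positivity
        linarith
    _ = _ := Real.exp_add _ _

namespace QMMSpace

variable {X : Type*} [MeasurableSpace X] [StandardBorelSpace X]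

/-- The expectation `∫ g d(d*(x, y))` of a function of the distance. -/
noncomputable def mean (Q : QMMSpace X) (g : C(I, ℝ)) (p : X × X) : ℝ := ∫ t, g t ∂(Q.dstar p)

theorem measurable_mean (Q : QMMSpace X) (g : C(I, ℝ)) : Measurable (Q.mean g) :=
  (StronglyMeasurable.integral_kernel g.continuous.stronglyMeasurable).measurable

theorem integrable_dstar (Q : QMMSpace X) (g : C(I, ℝ)) (p : X × X) :
    Integrable (fun t => g t) (Q.dstar p) :=
  .of_bound g.continuous.aestronglyMeasurable ‖g‖ (.of_forall g.norm_coe_le_norm)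

theorem abs_mean_le (Q : QMMSpace X) (g : C(I, ℝ)) (p : X × X) : |Q.mean g p| ≤ ‖g‖ := by
  simpa [mean] using norm_integral_le_of_norm_le_const (μ := Q.dstar p) (f := fun t => g t)
    (.of_forall g.norm_coe_le_norm)

/-- The deviation of `g (d(i,j))` from its conditional expectation given the points. -/
noncomputable def dev (Q : QMMSpace X) (g : C(I, ℝ)) (s : (ℕ → X) × (Edge → I)) (i j : ℕ) : ℝ :=
  g (sampleMatrix s.2 i j) - Q.mean g (s.1 i, s.1 j)

/-- Both `d(i,i) = 0` and `d*(x,x) = δ_0` enter here; consequently sums over rectangles need no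
diagonal correction. -/
theorem dev_self (Q : QMMSpace X) (g : C(I, ℝ)) (s : (ℕ → X) × (Edge → I)) (i : ℕ) :
    Q.dev g s i i = 0 := by
  simp [dev, mean, sampleMatrix, Q.dstar_self]

theorem dev_comm (Q : QMMSpace X) (g : C(I, ℝ)) (s : (ℕ → X) × (Edge → I)) (i j : ℕ) :
    Q.dev g s i j = Q.dev g s j i := by
  have h : sampleMatrix s.2 i j = sampleMatrix s.2 j i := by
    rcases lt_trichotomy i j with h | rfl | h
    · simp [sampleMatrix, h, h.not_gt]
    · rfl
    · simp [sampleMatrix, h, h.not_gt]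
  rw [dev, dev, h, mean, mean, Q.dstar_symm]

/-- The edges from a set `A` to a set `B` of larger indices. -/
def edges (A B : Finset ℕ) : Finset Edge := (A ×ˢ B).subtype fun e => e.1 < e.2

theorem card_edges_le (A B : Finset ℕ) : (edges A B).card ≤ A.card * B.card := by
  rw [edges, Finset.card_subtype, ← Finset.card_product]
  exact Finset.card_filter_le _ _

/-- An edge with both ends in `A ∩ B` occurs twice in the double sum. Splitting by `i < j` and `i >
j` makes each edge occur at most once per part, so that each part is a sum of conditionally
independent terms. -/
theorem sum_dev_eq (Q : QMMSpace X) (g : C(I, ℝ)) (s : (ℕ → X) × (Edge → I)) (A B : Finset ℕ) :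
    ∑ i ∈ A, ∑ j ∈ B, Q.dev g s i j =
      ∑ e ∈ edges A B, (g (s.2 e) - Q.mean g (s.1 e.1.1, s.1 e.1.2)) +
      ∑ e ∈ edges B A, (g (s.2 e) - Q.mean g (s.1 e.1.1, s.1 e.1.2)) := by
  have half : ∀ A B : Finset ℕ,
      ∑ e ∈ edges A B, (g (s.2 e) - Q.mean g (s.1 e.1.1, s.1 e.1.2)) =
        ∑ i ∈ A, ∑ j ∈ B, if i < j then Q.dev g s i j else 0 := by
    intro A B
    rw [← Finset.sum_product' A B fun i j => if i < j then Q.dev g s i j else 0,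
      ← Finset.sum_filter, ← Finset.sum_subtype_eq_sum_filter]
    refine Finset.sum_congr rfl fun e _ => ?_
    simp [dev, sampleMatrix, e.2]
  rw [half, half, Finset.sum_comm (s := B), ← Finset.sum_add_distrib]
  refine Finset.sum_congr rfl fun i _ => ?_
  rw [← Finset.sum_add_distrib]
  refine Finset.sum_congr rfl fun j _ => ?_
  rcases lt_trichotomy i j with h | rfl | h
  · simp [h, h.not_gt]
  · simp [dev_self]
  · simp [h, h.not_gt, dev_comm Q g s i j]

instance (Q : QMMSpace X) : IsProbabilityMeasure Q.sampleLaw :=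
  inferInstanceAs (IsProbabilityMeasure ((Measure.infinitePi fun _ : ℕ => Q.μ) ⊗ₘ Q.edgeKernel))

/-- Given the points, the edge lengths form a product measure and each summand is centred.
Hoeffding's bound does not depend on the points, so it survives integration over them. -/
theorem sampleLaw_edges_le (Q : QMMSpace X) (g : C(I, ℝ)) (E : Finset Edge) {M : ℝ}
    (hM : E.card * (2 * ‖g‖ + 1) ^ 2 ≤ M) {t : ℝ} (ht : 0 ≤ t) :
    Q.sampleLaw {s | t ≤ |∑ e ∈ E, (g (s.2 e) - Q.mean g (s.1 e.1.1, s.1 e.1.2))|} ≤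
      ENNReal.ofReal (2 * Real.exp (-t ^ 2 / (2 * M))) := by
  have hg : Measurable g := g.continuous.measurable
  have hG := Q.measurable_mean g
  have hS : MeasurableSet {s : (ℕ → X) × (Edge → I) |
      t ≤ |∑ e ∈ E, (g (s.2 e) - Q.mean g (s.1 e.1.1, s.1 e.1.2))|} := by
    refine measurableSet_le measurable_const ?_
    refine Measurable.abs (Finset.measurable_sum _ fun e _ => ?_)
    exact (hg.comp (by fun_prop)).sub (hG.comp (by fun_prop))
  rw [sampleLaw, Measure.compProd_apply hS]
  have key : ∀ x, Q.edgeKernel x (Prod.mk x ⁻¹' {s : (ℕ → X) × (Edge → I) |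
      t ≤ |∑ e ∈ E, (g (s.2 e) - Q.mean g (s.1 e.1.1, s.1 e.1.2))|}) ≤
        ENNReal.ofReal (2 * Real.exp (-t ^ 2 / (2 * M))) := by
    intro x
    refine infinitePi_le_abs_sum_le (fun e : Edge => Q.dstar (x e.1.1, x e.1.2))
      (h := fun e a => g a - Q.mean g (x e.1.1, x e.1.2)) (fun e => hg.sub_const _)
      (C := 2 * ‖g‖ + 1) (by positivity) (fun e a => ?_) (fun e => ?_) E hM ht
    · refine (abs_sub _ _).trans ?_
      have h1 := Q.abs_mean_le g (x e.1.1, x e.1.2)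
      have h2 := g.norm_coe_le_norm a
      rw [Real.norm_eq_abs] at h2
      linarith
    · rw [integral_sub (Q.integrable_dstar g _) (integrable_const _)]
      simp [mean]
  calc _ ≤ ∫⁻ _, ENNReal.ofReal (2 * Real.exp (-t ^ 2 / (2 * M)))
        ∂(Measure.infinitePi fun _ : ℕ => Q.μ) := lintegral_mono key
    _ = _ := by simp

/-- Almost surely the deviations are small on average over all rectangles `A × B`. -/
theorem ae_eventually_abs_sum_dev_le (Q : QMMSpace X) (g : C(I, ℝ)) {ε : ℝ} (hε : 0 < ε) :
    ∀ᵐ s ∂Q.sampleLaw, ∀ᶠ n : ℕ in atTop, ∀ A ⊆ Finset.range (n + 1),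
      ∀ B ⊆ Finset.range (n + 1),
        |∑ i ∈ A, ∑ j ∈ B, Q.dev g s i j| ≤ ε * ((n : ℝ) + 1) ^ 2 := by
  -- The threshold is `ε / 2` because the double sum splits into the edges from `A` to `B` and those
  -- from `B` to `A`.
  let S : ℕ → Finset ℕ → Finset ℕ → Set ((ℕ → X) × (Edge → I)) := fun n A B =>
    {s | ε / 2 * ((n : ℝ) + 1) ^ 2 ≤
      |∑ e ∈ edges A B, (g (s.2 e) - Q.mean g (s.1 e.1.1, s.1 e.1.2))|}
  let r : ℝ := ε ^ 2 / (8 * (2 * ‖g‖ + 1) ^ 2)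
  have hr : 0 < r := by positivity
  have hS : ∀ n, ∀ A ∈ (Finset.range (n + 1)).powerset, ∀ B ∈ (Finset.range (n + 1)).powerset,
      Q.sampleLaw (S n A B) ≤ ENNReal.ofReal (2 * Real.exp (-r * ((n : ℝ) + 1) ^ 2)) := by
    intro n A hA B hB
    have hcard : ((edges A B).card : ℝ) ≤ ((n : ℝ) + 1) ^ 2 := by
      have hA' := Finset.card_le_card (Finset.mem_powerset.1 hA)
      have hB' := Finset.card_le_card (Finset.mem_powerset.1 hB)
      rw [Finset.card_range] at hA' hB'
      have := (card_edges_le A B).trans (Nat.mul_le_mul hA' hB')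
      rw [← sq] at this
      exact_mod_cast this
    have h := Q.sampleLaw_edges_le g (edges A B)
      (M := ((n : ℝ) + 1) ^ 2 * (2 * ‖g‖ + 1) ^ 2) (by gcongr)
      (t := ε / 2 * ((n : ℝ) + 1) ^ 2) (by positivity)
    convert h using 4
    simp only [r]
    field_simp
    norm_num
  -- The union bound over `2^(n+1) * 2^(n+1)` pairs is affordable because the exponent is quadratic
  -- in `n`.
  have hae : ∀ᵐ s ∂Q.sampleLaw, ∀ᶠ n in atTop,
      s ∉ ⋃ A ∈ (Finset.range (n + 1)).powerset, ⋃ B ∈ (Finset.range (n + 1)).powerset,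
        S n A B := by
    refine ae_eventually_notMem_of_summable (b := fun n => (2 : ℝ) ^ (n + 1) * 2 ^ (n + 1) *
      (2 * Real.exp (-r * ((n : ℝ) + 1) ^ 2))) (fun n => ?_) ?_
    · calc _ ≤ ∑ A ∈ (Finset.range (n + 1)).powerset, ∑ B ∈ (Finset.range (n + 1)).powerset,
            ENNReal.ofReal (2 * Real.exp (-r * ((n : ℝ) + 1) ^ 2)) :=
            (measure_biUnion_finset_le _ _).trans (Finset.sum_le_sum fun A hA =>
              (measure_biUnion_finset_le _ _).trans (Finset.sum_le_sum fun B hB =>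
                hS n A hA B hB))
        _ = _ := by
            rw [Finset.sum_const, Finset.sum_const, Finset.card_powerset, Finset.card_range,
              ← ENNReal.ofReal_nsmul, ← ENNReal.ofReal_nsmul, nsmul_eq_mul, nsmul_eq_mul]
            push_cast
            rw [mul_assoc]
    · have := ((summable_nat_add_iff 1).2 (summable_four_pow_mul_exp_neg_sq hr)).mul_left 2
      refine this.congr fun n => ?_
      push_cast
      ring
  filter_upwards [hae] with s hs
  filter_upwards [hs] with n hn A hA B hB
  have hlt : ∀ A ⊆ Finset.range (n + 1), ∀ B ⊆ Finset.range (n + 1),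
      |∑ e ∈ edges A B, (g (s.2 e) - Q.mean g (s.1 e.1.1, s.1 e.1.2))| <
        ε / 2 * ((n : ℝ) + 1) ^ 2 := by
    intro A hA B hB
    by_contra hc
    exact hn (mem_biUnion (Finset.mem_powerset.2 hA)
      (mem_biUnion (Finset.mem_powerset.2 hB) (not_lt.1 hc)))
  rw [sum_dev_eq]
  refine (abs_add_le _ _).trans ?_
  linarith [hlt A hA B hB, hlt B hB A hA]

end QMMSpace

open UltraProd

/-! ## Determining integrals by a dense family of functions -/

theorem continuous_integral_of_abs_sub_le {E S : Type*} [PseudoMetricSpace E] [MeasurableSpace S]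
    {ν : Measure S} [IsFiniteMeasure ν] {u : E → S → ℝ} (hi : ∀ g, Integrable (u g) ν)
    (h : ∀ g g' p, |u g p - u g' p| ≤ dist g g') : Continuous fun g => ∫ p, u g p ∂ν := by
  refine (LipschitzWith.of_dist_le_mul (K := (ν.real univ).toNNReal) fun g g' => ?_).continuous
  rw [Real.dist_eq, ← integral_sub (hi g) (hi g'), Real.coe_toNNReal _ measureReal_nonneg, mul_comm]
  simpa using norm_integral_le_of_norm_le_const (μ := ν) (f := fun p => u g p - u g' p)
    (.of_forall (h g g'))

theorem abs_apply_sub_le_dist {Y : Type*} [TopologicalSpace Y] [CompactSpace Y] (g g' : C(Y, ℝ))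
    (y : Y) : |g y - g' y| ≤ dist g g' := by
  rw [← Real.dist_eq]
  exact ContinuousMap.dist_apply_le_dist y

theorem integrable_continuousMap {Y : Type*} [TopologicalSpace Y] [CompactSpace Y]
    [MeasurableSpace Y] [BorelSpace Y] {ν : Measure Y} [IsFiniteMeasure ν] (g : C(Y, ℝ)) :
    Integrable (fun y => g y) ν :=
  .of_bound g.continuous.measurable.aestronglyMeasurable ‖g‖ (.of_forall g.norm_coe_le_norm)

/-- Integrals are continuous in the test function for the sup norm, so a dense sequence suffices.
Countability matters because almost sure statements can be combined only over countably many test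
functions. -/
theorem measure_ext_of_denseSeq {Y : Type*} [MetricSpace Y] [CompactSpace Y] [MeasurableSpace Y]
    [BorelSpace Y] {ν ν' : Measure Y} [IsFiniteMeasure ν] [IsFiniteMeasure ν']
    (h : ∀ k, ∫ y, TopologicalSpace.denseSeq C(Y, ℝ) k y ∂ν =
      ∫ y, TopologicalSpace.denseSeq C(Y, ℝ) k y ∂ν') : ν = ν' := by
  have hall : (fun g : C(Y, ℝ) => ∫ y, g y ∂ν) = fun g : C(Y, ℝ) => ∫ y, g y ∂ν' :=
    (TopologicalSpace.denseRange_denseSeq C(Y, ℝ)).equalizer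
      (continuous_integral_of_abs_sub_le integrable_continuousMap abs_apply_sub_le_dist)
      (continuous_integral_of_abs_sub_le integrable_continuousMap abs_apply_sub_le_dist)
      (funext h)
  exact ext_of_forall_integral_eq_of_IsFiniteMeasure fun f => congrFun hall f.toContinuousMap

/-! ## Averages over the sampled finite spaces -/

theorem measureReal_unif_singleton (n : ℕ) (i : Fin (n + 1)) :
    (unif n).real {i} = ((n : ℝ) + 1)⁻¹ := by
  have : ((n : ℝ≥0∞) + 1).toReal = (n : ℝ) + 1 := by
    exact_mod_cast ENNReal.toReal_natCast (n + 1)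
  simp [unif, measureReal_def, uniformOn_univ, this]

theorem integral_unif (n : ℕ) (f : ℕ → ℝ) :
    ∫ i : Fin (n + 1), f i ∂(unif n) = (∑ i ∈ Finset.range (n + 1), f i) / ((n : ℝ) + 1) := by
  rw [integral_fintype .of_finite, Finset.sum_range]
  simp only [measureReal_unif_singleton, smul_eq_mul]
  rw [← Finset.mul_sum, div_eq_inv_mul]

theorem integral_unif_prod (n : ℕ) (F : Fin (n + 1) × Fin (n + 1) → ℝ) :
    ∫ p, F p ∂((unif n).prod (unif n)) = (∑ i, ∑ j, F (i, j)) / ((n : ℝ) + 1) ^ 2 := by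
  rw [integral_fintype .of_finite, Fintype.sum_prod_type, div_eq_inv_mul, Finset.mul_sum]
  refine Finset.sum_congr rfl fun i _ => ?_
  rw [Finset.mul_sum]
  refine Finset.sum_congr rfl fun j _ => ?_
  rw [← singleton_prod_singleton, measureReal_prod_prod, measureReal_unif_singleton,
    measureReal_unif_singleton, smul_eq_mul, ← sq, inv_pow]

open Classical in
/-- A set of indices of the `n`-th sampled space, as a finite set of natural numbers. -/
noncomputable def indexFinset {n : ℕ} (A : Set (Fin (n + 1))) : Finset ℕ :=
  (Finset.univ.filter (· ∈ A)).map Fin.valEmbedding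

theorem indexFinset_subset {n : ℕ} (A : Set (Fin (n + 1))) :
    indexFinset A ⊆ Finset.range (n + 1) := by
  intro i hi
  obtain ⟨j, -, rfl⟩ := Finset.mem_map.1 hi
  exact Finset.mem_range.2 j.2

theorem setIntegral_unif_prod (n : ℕ) (A B : Set (Fin (n + 1))) (f : ℕ → ℕ → ℝ) :
    ∫ p in A ×ˢ B, f p.1 p.2 ∂((unif n).prod (unif n)) =
      (∑ i ∈ indexFinset A, ∑ j ∈ indexFinset B, f i j) / ((n : ℝ) + 1) ^ 2 := by
  classical
  rw [← integral_indicator (.of_discrete), integral_unif_prod]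
  congr 1
  simp only [indexFinset, Finset.sum_map, Fin.valEmbedding_apply, Finset.sum_filter]
  refine Finset.sum_congr rfl fun i _ => ?_
  by_cases hi : i ∈ A
  · simp [hi, indicator_apply]
  · simp [hi]

/-! ## The realization of the ultralimit of the samples -/

section Realization

variable {X : Type*} [MetricSpace X] [CompactSpace X] (ω : Ultrafilter ℕ) (x : ℕ → X)

/-- The square of the realization. -/
noncomputable def pairMap (p : UltraSq ω unif) : X × X :=
  (ulimFun (sampleMap x) p.fst, ulimFun (sampleMap x) p.snd)

theorem hasUlim_pairMap : HasUlim (fun n (p : Fin (n + 1) × Fin (n + 1)) => (x p.1, x p.2))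
    (pairMap ω x) := fun z =>
  (tendsto_ulim ω fun n => x (z n).1).prodMk_nhds (tendsto_ulim ω fun n => x (z n).2)

variable [MeasurableSpace X] [BorelSpace X] [Nonprincipal ω]

theorem Nonprincipal.le_atTop : (ω : Filter ℕ) ≤ atTop := by
  intro s hs
  obtain ⟨N, hN⟩ := mem_atTop_sets.1 hs
  filter_upwards [Nonprincipal.eventually_ge ω N] with n hn using hN n hn

theorem measurable_realization :
    Measurable (ulimFun (sampleMap x) : UltraProd ω unif → X) :=
  (hasUlim_ulimFun _).measurable fun _ => .of_discrete

/-- Measurability for `𝓜 × 𝓜`, not merely for `𝓜₂`, is what makes the pull-back of `d*` eligible as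
a conditional expectation. -/
theorem measurable_pairMap : Measurable[UltraSq.prodAlgebra ω unif] (pairMap ω x) := by
  have h1 : Measurable[UltraSq.prodAlgebra ω unif] (UltraSq.fst : UltraSq ω unif → _) :=
    measurable_iff_comap_le.2 le_sup_left
  have h2 : Measurable[UltraSq.prodAlgebra ω unif] (UltraSq.snd : UltraSq ω unif → _) :=
    measurable_iff_comap_le.2 le_sup_right
  exact ((measurable_realization ω x).comp h1).prodMk ((measurable_realization ω x).comp h2)

variable {ω x}

/-- Continuous functions commute with ultralimits, so integrating them against the pushed measure
gives the limits of the sample averages. -/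
theorem map_realization_eq {μ : Measure X} [IsProbabilityMeasure μ]
    (h : ∀ k, Tendsto (fun n : ℕ => (∑ i ∈ Finset.range (n + 1),
      TopologicalSpace.denseSeq C(X, ℝ) k (x i)) / ((n : ℝ) + 1)) atTop
        (𝓝 (∫ a, TopologicalSpace.denseSeq C(X, ℝ) k a ∂μ))) :
    Measure.map (ulimFun (sampleMap x) : UltraProd ω unif → X) volume = μ := by
  have hm := measurable_realization ω x
  have := Measure.isProbabilityMeasure_map (μ := volume) hm.aemeasurable
  refine measure_ext_of_denseSeq fun k => ?_
  set f := TopologicalSpace.denseSeq C(X, ℝ) k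
  rw [integral_map hm.aemeasurable f.continuous.measurable.aestronglyMeasurable]
  refine tendsto_nhds_unique (((hasUlim_ulimFun (P := unif) (sampleMap x)).comp_continuous
    f.continuous).tendsto_integral (fun _ => .of_discrete) (C := ‖f‖)
    fun n a => f.norm_coe_le_norm _) ?_
  refine ((h k).mono_left (Nonprincipal.le_atTop ω)).congr fun n => ?_
  exact (integral_unif n fun i => f (x i)).symm

theorem measurePreserving_pairMap {μ : Measure X} [IsProbabilityMeasure μ]
    (h : Measure.map (ulimFun (sampleMap x) : UltraProd ω unif → X) volume = μ) :
    MeasurePreserving (pairMap ω x) volume (μ.prod μ) := by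
  have h1 : MeasurePreserving (ulimFun (sampleMap x) : UltraProd ω unif → X) volume μ :=
    ⟨measurable_realization ω x, h⟩
  exact (h1.prod h1).comp UltraSq.measurePreserving_fst_snd

theorem abs_setIntegral_sub_le {S : Type*} [MeasurableSpace S] {ν : Measure S} {f g : S → ℝ}
    (hf : Integrable f ν) (hg : Integrable g ν) (B : Set S) :
    |∫ s in B, f s ∂ν - ∫ s in B, g s ∂ν| ≤ ∫ s, |f s - g s| ∂ν := by
  rw [← integral_sub hf.integrableOn hg.integrableOn]
  exact (abs_integral_le_integral_abs).trans
    (setIntegral_le_integral (hf.sub hg).abs (.of_forall fun s => abs_nonneg _))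

theorem abs_setIntegral_comp_sub_le {S T : Type*} [MeasurableSpace S] [MeasurableSpace T]
    {ν : Measure S} {ρ : Measure T} {π : S → T} (hπ : MeasurePreserving π ν ρ) {f g : T → ℝ}
    (hf : Integrable f ρ) (hg : Integrable g ρ) (B : Set S) :
    |∫ s in B, f (π s) ∂ν - ∫ s in B, g (π s) ∂ν| ≤ ∫ t, |f t - g t| ∂ρ := by
  refine (abs_setIntegral_sub_le (hπ.integrable_comp_of_integrable hf)
    (hπ.integrable_comp_of_integrable hg) B).trans_eq ?_
  rw [← hπ.map_eq] at hf hg ⊢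
  exact (integral_map hπ.measurable.aemeasurable (hf.sub hg).abs.aestronglyMeasurable).symm

theorem QMMSpace.integrable_mean {X : Type*} [MeasurableSpace X] [StandardBorelSpace X]
    (Q : QMMSpace X) (g : C(I, ℝ)) {ρ : Measure (X × X)} [IsFiniteMeasure ρ] :
    Integrable (Q.mean g) ρ :=
  .of_bound (Q.measurable_mean g).aestronglyMeasurable ‖g‖ (.of_forall (Q.abs_mean_le g))

/-- On ultralimits of rectangles the integral of `g ∘ 𝐝` is the one predicted by `d*`, up to the
distance from `E g` to a continuous function. -/
theorem abs_setIntegral_internal_sub_le (Q : QMMSpace X) {l : Edge → I} (g : C(I, ℝ))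
    (hcut : ∀ m : ℕ, ∀ᶠ n : ℕ in atTop, ∀ A ⊆ Finset.range (n + 1),
      ∀ B ⊆ Finset.range (n + 1),
        |∑ i ∈ A, ∑ j ∈ B, Q.dev g (x, l) i j| ≤ 1 / ((m : ℝ) + 1) * ((n : ℝ) + 1) ^ 2)
    (hpush : MeasurePreserving (pairMap ω x) volume (Q.μ.prod Q.μ)) (H : C(X × X, ℝ))
    (hH : Tendsto (fun n : ℕ => (∑ i ∈ Finset.range (n + 1), ∑ j ∈ Finset.range (n + 1),
        |Q.mean g (x i, x j) - H (x i, x j)|) / ((n : ℝ) + 1) ^ 2) atTop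
        (𝓝 (∫ p, |Q.mean g p - H p| ∂(Q.μ.prod Q.μ))))
    (A B : ∀ n, Set (Fin (n + 1))) :
    |(∫ p in internal ω (fun n => (unif n).prod (unif n)) (fun n => A n ×ˢ B n),
        g (ulimFun (sampleDist l) p)) -
      ∫ p in internal ω (fun n => (unif n).prod (unif n)) (fun n => A n ×ˢ B n),
        Q.mean g (pairMap ω x p)| ≤ 2 * ∫ p, |Q.mean g p - H p| ∂(Q.μ.prod Q.μ) := by
  set e := ∫ p, |Q.mean g p - H p| ∂(Q.μ.prod Q.μ)
  set R := internal ω (fun n => (unif n).prod (unif n)) (fun n => A n ×ˢ B n)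
  have ha := ((hasUlim_ulimFun (ω := ω) (P := fun n => (unif n).prod (unif n))
    (sampleDist l)).comp_continuous g.continuous).tendsto_setIntegral (fun _ => .of_discrete)
    (C := ‖g‖) (fun n a => g.norm_coe_le_norm _) (A := fun n => A n ×ˢ B n)
    (fun _ => .of_discrete)
  have hc := ((hasUlim_pairMap ω x).comp_continuous H.continuous).tendsto_setIntegral
    (fun _ => .of_discrete) (C := ‖H‖) (fun n a => H.norm_coe_le_norm _)
    (A := fun n => A n ×ˢ B n) (fun _ => .of_discrete)
  -- The uniformity of `hcut` over all rectangles is essential: `A n` and `B n` are arbitrary and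
  -- may depend on the sample.
  have hab : Tendsto (fun n => ∫ p in A n ×ˢ B n, Q.dev g (x, l) p.1 p.2
      ∂((unif n).prod (unif n))) ω (𝓝 0) := by
    refine Tendsto.mono_left ?_ (Nonprincipal.le_atTop ω)
    rw [Metric.tendsto_nhds]
    intro δ hδ
    obtain ⟨m, hm⟩ := exists_nat_one_div_lt hδ
    filter_upwards [hcut m] with n hn
    rw [Real.dist_eq, sub_zero, setIntegral_unif_prod n (A n) (B n) (Q.dev g (x, l)), abs_div,
      abs_of_pos (by positivity : (0 : ℝ) < ((n : ℝ) + 1) ^ 2)]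
    refine lt_of_le_of_lt ?_ hm
    rw [div_le_iff₀ (by positivity)]
    exact hn _ (indexFinset_subset _) _ (indexFinset_subset _)
  have he : Tendsto (fun n => ∫ p : Fin (n + 1) × Fin (n + 1),
      |Q.mean g (x p.1, x p.2) - H (x p.1, x p.2)| ∂((unif n).prod (unif n))) ω (𝓝 e) := by
    refine (hH.mono_left (Nonprincipal.le_atTop ω)).congr fun n => ?_
    rw [integral_unif_prod, Finset.sum_range]
    simp only [Finset.sum_range]
  -- On the finite spaces `g ∘ d` is exchanged for `E g` at cost tending to `0`, then `E g` for `H`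
  -- at cost tending to `e`. Only the continuous function `H` is carried to the ultralimit, where
  -- `h2` turns it back into `E g` for another `e`.
  have h1 : |(∫ p in R, g (ulimFun (sampleDist l) p)) - ∫ p in R, H (pairMap ω x p)| ≤ 0 + e := by
    rw [← abs_zero]
    refine le_of_tendsto_of_tendsto' (ha.sub hc).abs (hab.abs.add he) fun n => ?_
    have hb : ∫ p in A n ×ˢ B n, Q.dev g (x, l) p.1 p.2 ∂((unif n).prod (unif n)) =
        (∫ p in A n ×ˢ B n, g (sampleDist l n p) ∂((unif n).prod (unif n))) -
          ∫ p in A n ×ˢ B n, Q.mean g (x p.1, x p.2) ∂((unif n).prod (unif n)) :=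
      integral_sub .of_finite .of_finite
    rw [hb]
    exact (abs_sub_le _ _ _).trans (add_le_add le_rfl
      (abs_setIntegral_sub_le .of_finite .of_finite _))
  have h2 : |(∫ p in R, H (pairMap ω x p)) - ∫ p in R, Q.mean g (pairMap ω x p)| ≤ e := by
    rw [abs_sub_comm]
    exact abs_setIntegral_comp_sub_le hpush (Q.integrable_mean g) (integrable_continuousMap H) R
  refine (abs_sub_le _ _ _).trans ((add_le_add h1 h2).trans_eq ?_)
  ring

/-- A bounded function whose integrals over all measurable rectangles vanish has vanishing
integrals over `𝓜 × 𝓜`. -/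
theorem setIntegral_eq_zero_of_rectangles {Y : ℕ → Type*} [∀ n, MeasurableSpace (Y n)]
    {P : ∀ n, Measure (Y n)} [∀ n, IsProbabilityMeasure (P n)] {φ : UltraSq ω P → ℝ}
    (hφ : Integrable φ)
    (h : ∀ M N : Set (UltraProd ω P), MeasurableSet M → MeasurableSet N →
      ∫ p in UltraSq.fst ⁻¹' M ∩ UltraSq.snd ⁻¹' N, φ p = 0)
    {B : Set (UltraSq ω P)} (hB : MeasurableSet[UltraSq.prodAlgebra ω P] B) :
    ∫ p in B, φ p = 0 := by
  let T : UltraSq ω P → UltraProd ω P × UltraProd ω P := fun p => (p.fst, p.snd)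
  have hT : Measurable T := UltraSq.measurable_fst.prodMk UltraSq.measurable_snd
  -- The square carries `𝓜 × 𝓜` as a pull-back from the genuine product, so the π-λ induction can
  -- run over measurable sets of that product.
  have hcomap : UltraSq.prodAlgebra ω P = MeasurableSpace.comap T inferInstance := by
    simp only [UltraSq.prodAlgebra, Prod.instMeasurableSpace, MeasurableSpace.prod,
      MeasurableSpace.comap_sup, MeasurableSpace.comap_comp]
    rfl
  rw [hcomap] at hB
  obtain ⟨B', hB', rfl⟩ := hB
  have huniv : ∫ p, φ p = 0 := by simpa using h univ univ .univ .univ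
  induction B', hB' using MeasurableSpace.induction_on_inter generateFrom_prod.symm
    isPiSystem_prod with
  | empty => simp
  | basic t ht =>
    obtain ⟨M, hM, N, hN, rfl⟩ := ht
    exact h M N hM hN
  | compl t ht ih =>
    rw [preimage_compl]
    have := integral_add_compl (hT ht) hφ
    linarith
  | iUnion f hd hf ih =>
    rw [preimage_iUnion, integral_iUnion (fun i => hT (hf i))
      (fun i j hij => (hd hij).preimage T) hφ.integrableOn]
    simp [ih]

end Realization

section Realization

variable {X : Type*} [MetricSpace X] [CompactSpace X] [MeasurableSpace X] [BorelSpace X]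
  {ω : Ultrafilter ℕ} [Nonprincipal ω] {x : ℕ → X} {l : Edge → I}

theorem integrable_comp_ulimDist (g : C(I, ℝ)) :
    Integrable fun p : UltraSq ω unif => g (ulimFun (sampleDist l) p) := by
  have hd : Measurable (ulimFun (sampleDist l) : UltraSq ω unif → I) :=
    (hasUlim_ulimFun _).measurable fun _ => .of_discrete
  exact .of_bound (g.continuous.measurable.comp hd).aestronglyMeasurable ‖g‖
    (.of_forall fun _ => g.norm_coe_le_norm _)

theorem integrable_mean_pairMap (Q : QMMSpace X) (g : C(I, ℝ)) :
    Integrable fun p => Q.mean g (pairMap ω x p) :=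
  .of_bound ((Q.measurable_mean g).comp
    ((measurable_pairMap ω x).mono UltraSq.prodAlgebra_le le_rfl)).aestronglyMeasurable ‖g‖
    (.of_forall fun _ => Q.abs_mean_le g _)

/-- The pull-back of `d*` by the realization. -/
noncomputable def pullback (Q : QMMSpace X) (ω : Ultrafilter ℕ) (x : ℕ → X)
    (p : UltraSq ω unif) : ProbabilityMeasure I :=
  ⟨Q.dstar (pairMap ω x p), inferInstance⟩

/-- The pull-back of `d*` is a version of the conditional distance, provided the sample satisfies
the laws of large numbers for a dense sequence of test functions. -/
theorem isUltraDistance_pullback (Q : QMMSpace X)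
    (hpush : MeasurePreserving (pairMap ω x) volume (Q.μ.prod Q.μ)) (H : ℕ → ℕ → C(X × X, ℝ))
    (hcut : ∀ k m : ℕ, ∀ᶠ n : ℕ in atTop, ∀ A ⊆ Finset.range (n + 1),
      ∀ B ⊆ Finset.range (n + 1),
        |∑ i ∈ A, ∑ j ∈ B, Q.dev (TopologicalSpace.denseSeq C(I, ℝ) k) (x, l) i j| ≤
          1 / ((m : ℝ) + 1) * ((n : ℝ) + 1) ^ 2)
    (hH : ∀ k m : ℕ, ∫ p, |Q.mean (TopologicalSpace.denseSeq C(I, ℝ) k) p - H k m p|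
      ∂(Q.μ.prod Q.μ) ≤ 1 / ((m : ℝ) + 1))
    (hlim : ∀ k m : ℕ, Tendsto (fun n : ℕ =>
      (∑ i ∈ Finset.range (n + 1), ∑ j ∈ Finset.range (n + 1),
        |Q.mean (TopologicalSpace.denseSeq C(I, ℝ) k) (x i, x j) - H k m (x i, x j)|) /
          ((n : ℝ) + 1) ^ 2) atTop
        (𝓝 (∫ p, |Q.mean (TopologicalSpace.denseSeq C(I, ℝ) k) p - H k m p|
          ∂(Q.μ.prod Q.μ)))) :
    IsUltraDistance ω unif (sampleDist l) (pullback Q ω x) := by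
  refine ⟨fun g => (Q.measurable_mean g).comp (measurable_pairMap ω x), fun g B hB => ?_⟩
  change ∫ p in B, Q.mean g (pairMap ω x p) = ∫ p in B, g (ulimFun (sampleDist l) p)
  have hdense : ∀ k,
      ∫ p in B, Q.mean (TopologicalSpace.denseSeq C(I, ℝ) k) (pairMap ω x p) =
        ∫ p in B, TopologicalSpace.denseSeq C(I, ℝ) k (ulimFun (sampleDist l) p) := by
    intro k
    set g := TopologicalSpace.denseSeq C(I, ℝ) k
    have hgi := integrable_comp_ulimDist (ω := ω) (l := l) g
    have hmi := integrable_mean_pairMap (ω := ω) (x := x) Q g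
    have h0 := setIntegral_eq_zero_of_rectangles (hgi.sub hmi) (fun M N hM hN => ?_) hB
    · have h1 := integral_sub (hgi.integrableOn (s := B)) (hmi.integrableOn (s := B))
      exact (sub_eq_zero.1 (h1.symm.trans h0)).symm
    · obtain ⟨A, hA⟩ := exists_approx hM
      obtain ⟨A', hA'⟩ := exists_approx hN
      rw [← setIntegral_congr_set (UltraSq.internal_prod_ae_eq hA hA')]
      refine (integral_sub hgi.integrableOn hmi.integrableOn).trans (abs_eq_zero.1 ?_)
      -- The left side does not involve the approximant `H k m`, so letting `m` grow forces it to
      -- vanish.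
      have hle : ∀ m : ℕ, _ ≤ 2 * (1 / ((m : ℝ) + 1)) := fun m =>
        (abs_setIntegral_internal_sub_le Q g (hcut k) hpush (H k m) (hlim k m) A A').trans
          (mul_le_mul_of_nonneg_left (hH k m) zero_le_two)
      have hzero : Tendsto (fun m : ℕ => 2 * (1 / ((m : ℝ) + 1))) atTop (𝓝 0) := by
        simpa using (tendsto_one_div_add_atTop_nhds_zero_nat (𝕜 := ℝ)).const_mul 2
      exact le_antisymm (ge_of_tendsto' hzero hle) (abs_nonneg _)
  -- Both sides are Lipschitz in `g` for the sup norm, so equality on the dense sequence extends to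
  -- all of `C(I, ℝ)`.
  have hall : (fun g : C(I, ℝ) => ∫ p in B, Q.mean g (pairMap ω x p)) =
      fun g : C(I, ℝ) => ∫ p in B, g (ulimFun (sampleDist l) p) := by
    refine (TopologicalSpace.denseRange_denseSeq C(I, ℝ)).equalizer
      (continuous_integral_of_abs_sub_le
        (fun g => (integrable_mean_pairMap Q g).integrableOn) fun g g' p => ?_)
      (continuous_integral_of_abs_sub_le
        (fun g => (integrable_comp_ulimDist g).integrableOn)
        fun g g' p => abs_apply_sub_le_dist g g' _) (funext hdense)
    rw [QMMSpace.mean, QMMSpace.mean, ← integral_sub (Q.integrable_dstar g _)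
      (Q.integrable_dstar g' _)]
    simpa using norm_integral_le_of_norm_le_const (μ := Q.dstar (pairMap ω x p))
      (f := fun t => g t - g' t) (.of_forall (abs_apply_sub_le_dist g g'))
  exact congrFun hall g

end Realization

/-- Two versions of a conditional derivative agree almost everywhere. -/
theorem IsCondDerivative.ae_eq {S : Type*} {𝓑 : MeasurableSpace S} [mS : MeasurableSpace S]
    {ν : Measure S} [IsFiniteMeasure ν] (h𝓑 : 𝓑 ≤ mS) {f : S → I}
    {E E' : S → ProbabilityMeasure I} (h : IsCondDerivative ν 𝓑 f E)
    (h' : IsCondDerivative ν 𝓑 f E') : ∀ᵐ s ∂ν, (E s : Measure I) = E' s := by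
  have hint : ∀ {D : S → ProbabilityMeasure I}, IsCondDerivative ν 𝓑 f D → ∀ g : C(I, ℝ),
      Integrable (fun s => ∫ t, g t ∂(D s : Measure I)) ν := fun {D} hD g =>
    .of_bound ((hD.measurable g).mono h𝓑 le_rfl).aestronglyMeasurable ‖g‖ (.of_forall fun s => by
      simpa using norm_integral_le_of_norm_le_const (μ := (D s : Measure I)) (f := fun t => g t)
        (.of_forall g.norm_coe_le_norm))
  -- For a single test function this is uniqueness of scalar conditional expectations; a dense
  -- sequence of them separates probability measures outside one null set.
  have hk : ∀ k, ∀ᵐ s ∂ν, ∫ t, TopologicalSpace.denseSeq C(I, ℝ) k t ∂(E s : Measure I) =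
      ∫ t, TopologicalSpace.denseSeq C(I, ℝ) k t ∂(E' s : Measure I) := fun k =>
    ae_eq_of_forall_setIntegral_eq_of_sigmaFinite' h𝓑
      (fun _ _ _ => (hint h _).integrableOn) (fun _ _ _ => (hint h' _).integrableOn)
      (fun B hB _ => (h.setIntegral_eq _ B hB).trans (h'.setIntegral_eq _ B hB).symm)
      (h.measurable _).stronglyMeasurable.aestronglyMeasurable
      (h'.measurable _).stronglyMeasurable.aestronglyMeasurable
  filter_upwards [ae_all_iff.2 hk] with s hs
  exact measure_ext_of_denseSeq hs

end QMM

/-! ### Assembly of the almost sure events -/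

theorem mainTheorem5 {X : Type*} [MetricSpace X] [CompactSpace X] [MeasurableSpace X]
    [BorelSpace X] (Q : QMM.QMMSpace X) (ω : Ultrafilter ℕ) [QMM.Nonprincipal ω] :
    ∀ᵐ s ∂Q.sampleLaw,
      QMM.IsSeparableRealization ω QMM.unif (QMM.sampleDist s.2) Q.μ Q.dstar
        (QMM.UltraProd.ulimFun (QMM.sampleMap s.1)) := by
  have hfst : MeasurePreserving Prod.fst Q.sampleLaw (Measure.infinitePi fun _ : ℕ => Q.μ) :=
    ⟨measurable_fst, Measure.fst_compProd _ _⟩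
  -- The approximants depend only on `μ` and `d*`, not on the sample, so the law of large numbers
  -- for pairs applies to `|E g - H|`. The three almost sure events below do not involve `ω`.
  have hH : ∀ k m : ℕ, ∃ H : C(X × X, ℝ),
      ∫ p, |Q.mean (TopologicalSpace.denseSeq C(I, ℝ) k) p - H p| ∂(Q.μ.prod Q.μ) ≤
        1 / ((m : ℝ) + 1) := by
    intro k m
    obtain ⟨H, hH, -⟩ := (Q.integrable_mean (TopologicalSpace.denseSeq C(I, ℝ) k)
      (ρ := Q.μ.prod Q.μ)).exists_boundedContinuous_integral_sub_le
      (ε := 1 / ((m : ℝ) + 1)) (by positivity)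
    exact ⟨H.toContinuousMap, hH⟩
  choose H hH using hH
  have hcut := ae_all_iff.2 fun k : ℕ => ae_all_iff.2 fun m : ℕ =>
    Q.ae_eventually_abs_sum_dev_le (TopologicalSpace.denseSeq C(I, ℝ) k)
      (ε := 1 / ((m : ℝ) + 1)) (by positivity)
  have havg := hfst.quasiMeasurePreserving.ae <| ae_all_iff.2 fun k : ℕ =>
    QMM.ae_tendsto_average Q.μ
      (TopologicalSpace.denseSeq C(X, ℝ) k).continuous.measurable
      (QMM.integrable_continuousMap _)
  have hpair := hfst.quasiMeasurePreserving.ae <| ae_all_iff.2 fun k : ℕ =>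
    ae_all_iff.2 fun m : ℕ => QMM.ae_tendsto_pair_average Q.μ
      (K := fun p => |Q.mean (TopologicalSpace.denseSeq C(I, ℝ) k) p - H k m p|)
      ((Q.measurable_mean _).sub (H k m).continuous.measurable).abs
      (C := ‖TopologicalSpace.denseSeq C(I, ℝ) k‖ + ‖H k m‖) (fun p => by
        rw [abs_abs]
        exact (abs_sub _ _).trans (add_le_add (Q.abs_mean_le _ p) ((H k m).norm_coe_le_norm p)))
  filter_upwards [hcut, havg, hpair] with s hs hs1 hs2
  have hmap := QMM.map_realization_eq (ω := ω) hs1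
  have hD := QMM.isUltraDistance_pullback (ω := ω) Q (QMM.measurePreserving_pairMap hmap) H
    hs hH hs2
  exact ⟨QMM.measurable_realization ω s.1, hmap, ⟨_, hD⟩, fun D hD' =>
    QMM.IsCondDerivative.ae_eq QMM.UltraSq.prodAlgebra_le hD hD'⟩
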